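/- Let $\mathcal{A}$ be a unital exact $C^*$-algebra, $\theta\in\mathrm{Aut}(\mathcal{A})$ and $a=a^*\in\mathcal{A}$. Let $u$ be the canonical unitary implementing $\theta$ in the crossed product $\mathcal{A}\rtimes_\theta\mathbb{Z}$, and identify $a$ with its image under the natural inclusion $\mathcal{A}\hookrightarrow\mathcal{A}\rtimes_\theta\mathbb{Z}$. Then $$P_\theta(a)=P_{\mathrm{Ad}\,u}(a).$$ Here $\mathcal{A}\rtimes_\theta\mathbb{Z}$ is realized, from any faithful unital representation $\pi_0:\mathcal{A}\to\mathcal{B}(\mathcal{H}_0)$, as the $C^*$-algebra of operators on $\ell^2(\mathbb{Z},\mathcal{H}_0)$ generated by the operators $(\tilde\pi(x)\xi)(n)=\pi_0(\theta^{-n}(x))\xi(n)$, $x\in\mathcal{A}$, and the translation $(u\xi)(n)=\xi(n-1)$; the natural inclusion is $x\mapsto\tilde\pi(x)$, and $\mathrm{Ad}\,u(y)=uyu^*$. For a unital $C^*$-algebra $\mathcal{C}$, an automorphism $\alpha$ of $\mathcal{C}$ and $c=c^*\in\mathcal{C}$, the approximation pressure $P_\alpha(c)\in[-\infty,+\infty]$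 is defined as follows. Fix a faithful unital $*$-representation $\pi:\mathcal{C}\to\mathcal{B}(\mathcal{H})$. For a subset $S\subset\mathcal{C}$ and $\delta>0$ let $\mathrm{CPA}(\pi,S,\delta)$ be the set of triples $(\phi,\psi,\mathcal{B})$ in which $\mathcal{B}$ is a finite-dimensional $C^*$-algebra and $\phi:\mathcal{C}\to\mathcal{B}$, $\psi:\mathcal{B}\to\mathcal{B}(\mathcal{H})$ are unital completely positive maps with $\|\psi(\phi(x))-\pi(x)\|<\delta$ for all $x\in S$. For a finite set $\Omega\subset\mathcal{C}$ put $\Omega^{(n)}=\bigcup_{j=0}^{n-1}\alpha^j(\Omega)$, $c^{(n)}=\sum_{j=0}^{n-1}\alpha^j(c)$ and $$Z_{\alpha,n}(\pi,c,\Omega,\delta)=\inf\{\mathrm{Tr}\,e^{\phi(c^{(n)})} : (\phi,\psi,\mathcal{B})\in\mathrm{CPA}(\pi,\Omega^{(n)},\delta)\},$$ where $\mathrm{Tr}$ is the trace of $\mathcal{B}$ taking the value $1$ on every minimal projection. Then $$P_\alpha(c)=\sup_{\Omega}\,\sup_{\delta>0}\,\limsup_{n\to\infty}\frac1n\log Z_{\alpha,n}(\pi,c,\Omega,\delta).$$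 The equality holds for every choice of $\pi_0$ and of the faithful unital representations of $\mathcal{A}$ and of $\mathcal{A}\rtimes_\theta\mathbb{Z}$ used to compute the two pressures. -/

import Mathlib

open scoped TensorProduct InnerProductSpace ENNReal

noncomputable section

namespace CStarPressure

universe u v w

/-! ## The minimal tensor product and exact C*-algebras -/

/-- A *-representation of a C*-algebra on a Hilbert space. -/
structure Rep (A : Type u) [NonUnitalCStarAlgebra A] : Type (u + 1) where
  carrier : Type u
  [normed : NormedAddCommGroup carrier]
  [inner : InnerProductSpace ℂ carrier]
  [complete : CompleteSpace carrier]
  hom : A →⋆ₙₐ[ℂ] (carrier →L[ℂ] carrier)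

attribute [instance] Rep.normed Rep.inner Rep.complete

section MinTensor

variable {A B C : Type u} [NonUnitalCStarAlgebra A] [NonUnitalCStarAlgebra B]
  [NonUnitalCStarAlgebra C]

/-- The representation `π ⊗ ρ : a ⊗ b ↦ π a ⊗ ρ b` of the algebraic tensor product `A ⊗ B` on
the algebraic tensor product of the two Hilbert spaces with its inner product norm. (The norm of
a bounded operator there is the norm of its extension to the Hilbert space tensor product.) -/
def tensorRep (π : Rep A) (ρ : Rep B) :
    A ⊗[ℂ] B →ₗ[ℂ] (π.carrier ⊗[ℂ] ρ.carrier →L[ℂ] π.carrier ⊗[ℂ] ρ.carrier) :=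
  TensorProduct.lift (LinearMap.mk₂ ℂ (fun a b => TensorProduct.mapL (π.hom a) (ρ.hom b))
    (fun a a' b => by rw [map_add, TensorProduct.mapL_add_left])
    (fun c a b => by rw [map_smul, TensorProduct.mapL_smul_left])
    (fun a b b' => by rw [map_add, TensorProduct.mapL_add_right])
    (fun c a b => by rw [map_smul, TensorProduct.mapL_smul_right]))

theorem tensorRep_tmul (π : Rep A) (ρ : Rep B) (a : A) (b : B) :
    tensorRep π ρ (a ⊗ₜ[ℂ] b) = TensorProduct.mapL (π.hom a) (ρ.hom b) := rfl

/-- The minimal (spatial) C*-norm on the algebraic tensor product: the supremum of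
`‖(π ⊗ ρ) x‖` over all pairs of *-representations. -/
def minNorm (x : A ⊗[ℂ] B) : ℝ := ⨆ p : Rep A × Rep B, ‖tensorRep p.1 p.2 x‖

theorem minNorm_bddAbove (x : A ⊗[ℂ] B) :
    BddAbove (Set.range fun p : Rep A × Rep B => ‖tensorRep p.1 p.2 x‖) := by
  induction x using TensorProduct.induction_on with
  | zero =>
    refine ⟨0, ?_⟩
    rintro _ ⟨p, rfl⟩
    simp only [map_zero]
    exact ContinuousLinearMap.opNorm_zero.le
  | tmul a b =>
    refine ⟨‖a‖ * ‖b‖, ?_⟩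
    rintro _ ⟨p, rfl⟩
    simp only [tensorRep_tmul]
    refine (TensorProduct.norm_mapL_le _ _).trans ?_
    gcongr
    · exact NonUnitalStarAlgHom.norm_apply_le p.1.hom a
    · exact NonUnitalStarAlgHom.norm_apply_le p.2.hom b
  | add x y hx hy =>
    obtain ⟨c, hc⟩ := hx
    obtain ⟨d, hd⟩ := hy
    refine ⟨c + d, ?_⟩
    rintro _ ⟨p, rfl⟩
    simp only [map_add]
    exact (ContinuousLinearMap.opNorm_add_le _ _).trans
      (add_le_add (hc ⟨p, rfl⟩) (hd ⟨p, rfl⟩))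

theorem minNorm_nonneg (x : A ⊗[ℂ] B) : 0 ≤ minNorm x :=
  Real.iSup_nonneg fun _ => ContinuousLinearMap.opNorm_nonneg _

theorem minNorm_zero : minNorm (0 : A ⊗[ℂ] B) = 0 := by
  refine le_antisymm (Real.iSup_le (fun p => ?_) le_rfl) (minNorm_nonneg _)
  rw [map_zero]
  exact ContinuousLinearMap.opNorm_zero.le

theorem minNorm_add_le (x y : A ⊗[ℂ] B) : minNorm (x + y) ≤ minNorm x + minNorm y := by
  refine Real.iSup_le (fun p => ?_) (add_nonneg (minNorm_nonneg x) (minNorm_nonneg y))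
  rw [map_add]
  exact (ContinuousLinearMap.opNorm_add_le _ _).trans
    (add_le_add (le_ciSup (minNorm_bddAbove x) p) (le_ciSup (minNorm_bddAbove y) p))

theorem minNorm_neg (x : A ⊗[ℂ] B) : minNorm (-x) = minNorm x := by
  refine congrArg iSup (funext fun p => ?_)
  rw [map_neg]
  exact ContinuousLinearMap.opNorm_neg _

/-- The algebraic tensor product equipped with the minimal C*-norm. -/
def AlgMinTensor (A B : Type u) [NonUnitalCStarAlgebra A] [NonUnitalCStarAlgebra B] : Type u :=
  A ⊗[ℂ] B

instance : AddCommGroup (AlgMinTensor A B) := inferInstanceAs (AddCommGroup (A ⊗[ℂ] B))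

instance : SeminormedAddCommGroup (AlgMinTensor A B) :=
  AddGroupSeminorm.toSeminormedAddCommGroup
    { toFun := fun x : AlgMinTensor A B => minNorm (A := A) (B := B) x
      map_zero' := minNorm_zero
      add_le' := minNorm_add_le
      neg' := minNorm_neg }

/-- The minimal tensor product `A ⊗_min B` (its underlying normed group). -/
abbrev MinTensor (A B : Type u) [NonUnitalCStarAlgebra A] [NonUnitalCStarAlgebra B] : Type u :=
  UniformSpace.Completion (AlgMinTensor A B)

theorem minNorm_lTensor_le (f : B →⋆ₙₐ[ℂ] C) (x : A ⊗[ℂ] B) :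
    minNorm (LinearMap.lTensor A (f : B →ₗ[ℂ] C) x) ≤ minNorm x := by
  refine Real.iSup_le (fun p => ?_) (minNorm_nonneg x)
  let q : Rep A × Rep B := (p.1, { carrier := p.2.carrier, hom := p.2.hom.comp f })
  have key : tensorRep p.1 p.2 (LinearMap.lTensor A (f : B →ₗ[ℂ] C) x)
      = tensorRep q.1 q.2 x := by
    induction x using TensorProduct.induction_on with
    | zero => simp
    | tmul a b => rfl
    | add x y hx hy => rw [map_add, map_add, map_add, hx, hy]
  rw [key]
  exact le_ciSup (minNorm_bddAbove x) q

/-- The map `id ⊗ f : A ⊗_min B → A ⊗_min C` induced by a *-homomorphism `f : B → C`. -/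
def minTensorMap (A : Type u) [NonUnitalCStarAlgebra A] (f : B →⋆ₙₐ[ℂ] C) :
    NormedAddGroupHom (MinTensor A B) (MinTensor A C) :=
  NormedAddGroupHom.completion
    (AddMonoidHom.mkNormedAddGroupHom
      ((LinearMap.lTensor A (f : B →ₗ[ℂ] C)).toAddMonoidHom :
        AlgMinTensor A B →+ AlgMinTensor A C) 1
      (fun x => by rw [one_mul]; exact minNorm_lTensor_le f x))

end MinTensor

/-- A C*-algebra `A` is exact if `A ⊗_min ·` sends every short exact sequence
`0 → J → B → C → 0` of C*-algebras to a short exact sequence. -/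
def IsExact (A : Type u) [NonUnitalCStarAlgebra A] : Prop :=
  ∀ (J B C : Type u) [NonUnitalCStarAlgebra J] [NonUnitalCStarAlgebra B]
    [NonUnitalCStarAlgebra C] (i : J →⋆ₙₐ[ℂ] B) (q : B →⋆ₙₐ[ℂ] C),
    Function.Injective i → Function.Exact i q → Function.Surjective q →
      Function.Injective (minTensorMap A i) ∧
      Function.Exact (minTensorMap A i) (minTensorMap A q) ∧
      Function.Surjective (minTensorMap A q)

/-! ## The approximation pressure -/

/-- Unital completely positive maps. Complete positivity is Mathlib's, for the canonical order of
the C*-algebras. -/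
def IsUCP {A : Type u} {B : Type v} [CStarAlgebra A] [CStarAlgebra B] (φ : A →ₗ[ℂ] B) : Prop :=
  letI := CStarAlgebra.spectralOrder A
  letI := CStarAlgebra.spectralOrder B
  letI := CStarAlgebra.spectralOrderedRing A
  letI := CStarAlgebra.spectralOrderedRing B
  φ 1 = 1 ∧ ∃ Φ : CompletelyPositiveMap A B, Φ.toLinearMap = φ

/-- A minimal projection: a nonzero projection dominating no projection but `0` and itself. -/
def IsMinimalProjection {B : Type u} [CStarAlgebra B] (e : B) : Prop :=
  IsStarProjection e ∧ e ≠ 0 ∧ ∀ f : B, IsStarProjection f → e * f = f → f = 0 ∨ f = e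

/-- `τ` is the trace `Tr` of the finite-dimensional C*-algebra `B`: the (unique) tracial linear
functional with value `1` on every minimal projection. -/
def IsCanonicalTrace {B : Type u} [CStarAlgebra B] (τ : B →ₗ[ℂ] ℂ) : Prop :=
  (∀ x y, τ (x * y) = τ (y * x)) ∧ ∀ e, IsMinimalProjection e → τ e = 1

section Pressure

variable {A : Type u} [CStarAlgebra A] {H : Type v} [NormedAddCommGroup H]
  [InnerProductSpace ℂ H] [CompleteSpace H]

/-- The collection `CPA(π, S, δ)` of completely positive approximations `(φ, ψ, B)`, together
with the canonical trace of `B`. Every finite-dimensional C*-algebra is isomorphic to one in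
`Type`. -/
structure CPA (π : A →⋆ₐ[ℂ] (H →L[ℂ] H)) (S : Set A) (δ : ℝ) where
  B : Type
  [cstar : CStarAlgebra B]
  [finDim : FiniteDimensional ℂ B]
  φ : A →ₗ[ℂ] B
  ψ : B →ₗ[ℂ] (H →L[ℂ] H)
  Tr : B →ₗ[ℂ] ℂ
  isUCP_φ : IsUCP φ
  isUCP_ψ : IsUCP ψ
  isCanonicalTrace : IsCanonicalTrace Tr
  approx : ∀ x ∈ S, ‖ψ (φ x) - π x‖ < δ

attribute [instance] CPA.cstar CPA.finDim

/-- `Ω ∪ θ(Ω) ∪ ⋯ ∪ θ^{n-1}(Ω)`. -/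
def orbitSet (θ : A → A) (Ω : Set A) (n : ℕ) : Set A :=
  ⋃ j ∈ Finset.range n, θ^[j] '' Ω

/-- `a + θ(a) + ⋯ + θ^{n-1}(a)`. -/
def orbitSum (θ : A → A) (a : A) (n : ℕ) : A := ∑ j ∈ Finset.range n, θ^[j] a

/-- The partition function: the infimum of `Tr e^{φ(a^{(n)})}` (a nonnegative real number when
`a` is self-adjoint and `θ` is *-preserving) over `CPA(π, Ω^{(n)}, δ)`. -/
def partitionFunction (π : A →⋆ₐ[ℂ] (H →L[ℂ] H)) (θ : A → A) (a : A) (Ω : Set A) (δ : ℝ)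
    (n : ℕ) : ℝ≥0∞ :=
  ⨅ c : CPA π (orbitSet θ Ω n) δ,
    ENNReal.ofReal (c.Tr (NormedSpace.exp (c.φ (orbitSum θ a n)))).re

/-- `P_θ(π, a, Ω, δ) = limsup_n (1/n) log Z_{θ,n}(π, a, Ω, δ)`. -/
def localPressure (π : A →⋆ₐ[ℂ] (H →L[ℂ] H)) (θ : A → A) (a : A) (Ω : Set A) (δ : ℝ) : EReal :=
  Filter.limsup (fun n : ℕ => ENNReal.log (partitionFunction π θ a Ω δ n) / (n : EReal))
    Filter.atTop

/-- The approximation pressure `P_θ(π, a)`, as an extended real number: the supremum of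
`P_θ(π, a, Ω, δ)` over all finite subsets `Ω` and all `δ > 0`. -/
def pressure (π : A →⋆ₐ[ℂ] (H →L[ℂ] H)) (θ : A → A) (a : A) : EReal :=
  ⨆ Ω : Finset A, ⨆ δ : Set.Ioi (0 : ℝ), localPressure π θ a (Ω : Set A) δ

end Pressure

/-! ## The crossed product by a single automorphism -/

/-- The Hilbert space `ℓ²(ℤ, H)`. -/
abbrev L2Z (H : Type v) [NormedAddCommGroup H] : Type v := lp (fun _ : ℤ => H) 2

section L2

variable {H : Type v} [NormedAddCommGroup H]

theorem memℓp_of_norm_le {ξ : L2Z H} {η : ℤ → H} {c : ℝ} (h : ∀ n, ‖η n‖ ≤ c * ‖ξ n‖) :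
    Memℓp η 2 := by
  refine memℓp_gen ?_
  have hs : Summable fun n => c ^ 2 * ‖ξ n‖ ^ 2 := by
    have := (lp.memℓp ξ).summable (by norm_num)
    simp only [ENNReal.toReal_ofNat, Real.rpow_two] at this
    exact this.mul_left _
  refine hs.of_nonneg_of_le (fun n => by positivity) (fun n => ?_)
  simp only [ENNReal.toReal_ofNat, Real.rpow_two]
  rw [← mul_pow]
  exact pow_le_pow_left₀ (norm_nonneg _) (h n) 2

theorem norm_le_of_norm_le {ξ η : L2Z H} {c : ℝ} (hc : 0 ≤ c) (h : ∀ n, ‖η n‖ ≤ c * ‖ξ n‖) :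
    ‖η‖ ≤ c * ‖ξ‖ := by
  refine lp.norm_le_of_forall_sum_le (by norm_num) (by positivity) (fun s => ?_)
  simp only [ENNReal.toReal_ofNat, Real.rpow_two]
  calc ∑ n ∈ s, ‖η n‖ ^ 2 ≤ ∑ n ∈ s, c ^ 2 * ‖ξ n‖ ^ 2 :=
        Finset.sum_le_sum fun n _ => by
          rw [← mul_pow]
          exact pow_le_pow_left₀ (norm_nonneg _) (h n) 2
    _ = c ^ 2 * ∑ n ∈ s, ‖ξ n‖ ^ 2 := by rw [Finset.mul_sum]
    _ ≤ c ^ 2 * ‖ξ‖ ^ 2 := by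
        have := lp.sum_rpow_le_norm_rpow (p := 2) (by norm_num) ξ s
        simp only [ENNReal.toReal_ofNat, Real.rpow_two] at this
        gcongr
    _ = (c * ‖ξ‖) ^ 2 := by rw [mul_pow]

theorem memℓp_shift (ξ : L2Z H) (k : ℤ) : Memℓp (fun n : ℤ => ξ (n + k)) 2 := by
  refine memℓp_gen ?_
  have := (lp.memℓp ξ).summable (by norm_num)
  exact ((Equiv.addRight k).summable_iff (f := fun n => ‖ξ n‖ ^ (2 : ℝ≥0∞).toReal)).2 this

variable [InnerProductSpace ℂ H]

/-- The shift `ξ ↦ (n ↦ ξ(n + k))` of `ℓ²(ℤ, H)`. -/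
def shift (H : Type v) [NormedAddCommGroup H] [InnerProductSpace ℂ H] (k : ℤ) :
    L2Z H →ₗ[ℂ] L2Z H where
  toFun ξ := ⟨fun n : ℤ => ξ (n + k), memℓp_shift ξ k⟩
  map_add' _ _ := rfl
  map_smul' _ _ := rfl

theorem shift_apply (k : ℤ) (ξ : L2Z H) (n : ℤ) : shift H k ξ n = ξ (n + k) := rfl

theorem norm_shift (k : ℤ) (ξ : L2Z H) : ‖shift H k ξ‖ = ‖ξ‖ := by
  rw [lp.norm_eq_tsum_rpow (by norm_num), lp.norm_eq_tsum_rpow (by norm_num)]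
  congr 1
  exact (Equiv.addRight k).tsum_eq fun n => ‖ξ n‖ ^ (2 : ℝ≥0∞).toReal

end L2

section CrossedProduct

variable {A : Type u} [CStarAlgebra A] {H : Type v} [NormedAddCommGroup H]
  [InnerProductSpace ℂ H] [CompleteSpace H]

theorem norm_rep_apply_le (π : A →⋆ₐ[ℂ] (H →L[ℂ] H)) (θ : A ≃⋆ₐ[ℂ] A) (a : A) (x : H) :
    ‖π (θ a) x‖ ≤ ‖a‖ * ‖x‖ := by
  refine (ContinuousLinearMap.le_opNorm _ _).trans ?_
  gcongr
  exact (NonUnitalStarAlgHom.norm_apply_le π _).trans (NonUnitalStarAlgHom.norm_apply_le θ a)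

/-- The operator `(π̃(a) ξ)(n) = π(θ^{-n}(a)) ξ(n)` on `ℓ²(ℤ, H)`. -/
def regularOp (π : A →⋆ₐ[ℂ] (H →L[ℂ] H)) (θ : A ≃⋆ₐ[ℂ] A) (a : A) : L2Z H →L[ℂ] L2Z H :=
  LinearMap.mkContinuous
    { toFun := fun ξ => ⟨fun n : ℤ => π ((θ ^ (-n)) a) (ξ n),
        memℓp_of_norm_le (ξ := ξ) fun n => norm_rep_apply_le π (θ ^ (-n)) a (ξ n)⟩
      map_add' := fun ξ η => by ext n; exact map_add _ _ _
      map_smul' := fun c ξ => by ext n; exact map_smul _ _ _ }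
    ‖a‖ (fun ξ => norm_le_of_norm_le (norm_nonneg a)
      fun n => norm_rep_apply_le π (θ ^ (-n)) a (ξ n))

theorem regularOp_apply (π : A →⋆ₐ[ℂ] (H →L[ℂ] H)) (θ : A ≃⋆ₐ[ℂ] A) (a : A) (ξ : L2Z H)
    (n : ℤ) : regularOp π θ a ξ n = π ((θ ^ (-n)) a) (ξ n) := rfl

/-- The representation `π̃` of `A` on `ℓ²(ℤ, H)`. -/
def regularRep (π : A →⋆ₐ[ℂ] (H →L[ℂ] H)) (θ : A ≃⋆ₐ[ℂ] A) :
    A →⋆ₐ[ℂ] (L2Z H →L[ℂ] L2Z H) where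
  toFun := regularOp π θ
  map_one' := by ext ξ n; simp [regularOp_apply]
  map_mul' a b := by ext ξ n; simp [regularOp_apply]
  map_zero' := by ext ξ n; simp [regularOp_apply]
  map_add' a b := by ext ξ n; simp [regularOp_apply]
  commutes' c := by
    ext ξ n
    simp [regularOp_apply, Algebra.algebraMap_eq_smul_one]
  map_star' a := by
    rw [ContinuousLinearMap.star_eq_adjoint, ContinuousLinearMap.eq_adjoint_iff]
    intro ξ η
    rw [lp.inner_eq_tsum, lp.inner_eq_tsum]
    refine tsum_congr fun n => ?_
    rw [regularOp_apply, regularOp_apply, map_star, map_star,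
      ContinuousLinearMap.star_eq_adjoint, ContinuousLinearMap.adjoint_inner_left]

/-- The translation `(λ ξ)(n) = ξ(n - 1)` on `ℓ²(ℤ, H)`, a unitary operator. -/
def translation (H : Type v) [NormedAddCommGroup H] [InnerProductSpace ℂ H] [CompleteSpace H] :
    unitary (L2Z H →L[ℂ] L2Z H) :=
  Unitary.linearIsometryEquiv.symm
    { toLinearEquiv := LinearEquiv.ofLinearMap (shift H (-1)) (shift H 1)
        (by ext ξ n; simp [shift_apply]) (by ext ξ n; simp [shift_apply])
      norm_map' := norm_shift (-1) }

theorem translation_apply (ξ : L2Z H) (n : ℤ) :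
    (translation H : L2Z H →L[ℂ] L2Z H) ξ n = ξ (n - 1) := rfl

/-- The crossed product `A ⋊_θ ℤ`: the C*-algebra of operators on `ℓ²(ℤ, H)` generated by
`π̃(A)` and the translation, where `π` is a faithful unital representation of `A` on `H`. -/
def crossedProduct (π : A →⋆ₐ[ℂ] (H →L[ℂ] H)) (θ : A ≃⋆ₐ[ℂ] A) :
    StarSubalgebra ℂ (L2Z H →L[ℂ] L2Z H) :=
  (StarAlgebra.adjoin ℂ (Set.range (regularRep π θ) ∪
    {(translation H : L2Z H →L[ℂ] L2Z H)})).topologicalClosure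

instance crossedProduct_isClosed (π : A →⋆ₐ[ℂ] (H →L[ℂ] H)) (θ : A ≃⋆ₐ[ℂ] A) :
    IsClosed (crossedProduct π θ : Set (L2Z H →L[ℂ] L2Z H)) :=
  StarSubalgebra.isClosed_topologicalClosure _

/-- The natural inclusion `A → A ⋊_θ ℤ`. -/
def inclusion (π : A →⋆ₐ[ℂ] (H →L[ℂ] H)) (θ : A ≃⋆ₐ[ℂ] A) :
    A →⋆ₐ[ℂ] crossedProduct π θ :=
  (regularRep π θ).codRestrict (crossedProduct π θ) fun a =>
    StarSubalgebra.le_topologicalClosure _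
      (StarAlgebra.subset_adjoin ℂ _ (Or.inl ⟨a, rfl⟩))

/-- The canonical unitary `u` of `A ⋊_θ ℤ`. -/
def canonicalUnitary (π : A →⋆ₐ[ℂ] (H →L[ℂ] H)) (θ : A ≃⋆ₐ[ℂ] A) :
    unitary (crossedProduct π θ) :=
  ⟨⟨translation H, StarSubalgebra.le_topologicalClosure _
      (StarAlgebra.subset_adjoin ℂ _ (Or.inr rfl))⟩,
    Unitary.mem_iff.2 ⟨Subtype.ext (Unitary.star_mul_self_of_mem (translation H).2),
      Subtype.ext (Unitary.mul_star_self_of_mem (translation H).2)⟩⟩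

/-- The inner automorphism `Ad u : x ↦ u x u*` of `A ⋊_θ ℤ`. -/
def adUnitary (π : A →⋆ₐ[ℂ] (H →L[ℂ] H)) (θ : A ≃⋆ₐ[ℂ] A) :
    crossedProduct π θ ≃⋆ₐ[ℂ] crossedProduct π θ :=
  Unitary.conjStarAlgAut ℂ (crossedProduct π θ) (canonicalUnitary π θ)

/-- The canonical unitary implements the automorphism: `u a u* = θ(a)`. -/
theorem adUnitary_inclusion (π : A →⋆ₐ[ℂ] (H →L[ℂ] H)) (θ : A ≃⋆ₐ[ℂ] A) (a : A) :
    adUnitary π θ (inclusion π θ a) = inclusion π θ (θ a) := by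
  have h : (translation H : L2Z H →L[ℂ] L2Z H) * regularRep π θ a
      = regularRep π θ (θ a) * (translation H : L2Z H →L[ℂ] L2Z H) := by
    ext ξ n
    change π ((θ ^ (-(n - 1))) a) (ξ (n - 1)) = π ((θ ^ (-n)) (θ a)) (ξ (n - 1))
    have : θ ^ (-(n - 1)) = θ ^ (-n) * θ := by
      rw [← zpow_add_one]; congr 1; ring
    rw [this]
    rfl
  apply Subtype.ext
  change (translation H : L2Z H →L[ℂ] L2Z H) * regularRep π θ a
    * star (translation H : L2Z H →L[ℂ] L2Z H) = regularRep π θ (θ a)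
  rw [h, mul_assoc, Unitary.mul_star_self_of_mem (translation H).2, mul_one]

end CrossedProduct

end CStarPressure

end

open scoped TensorProduct InnerProductSpace ENNReal

noncomputable section

namespace CStarPressure

-- Both inequalities transport completely positive approximations between `A` and its crossed
-- product, changing the partition function by at most a factor independent of `n`; such a factor
-- disappears after taking `(1/n) log`.
--
-- Passing from the crossed product to `A` is restriction: compose `φ` with the inclusion. Only the
-- ambient representation has to be changed, which `exists_ucp_extension` does: if `π` is faithful,
-- any representation `σ` of the same algebra factors as `Φ ∘ π` with `Φ` ucp on all bounded
-- operators. It is obtained by splitting `σ` into cyclic pieces, extending each vector state by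
-- Hahn–Banach, and compressing the direct sum of the GNS representations by an isometry.
--
-- In the other direction, cut an operator on `ℓ²(ℤ, H₀)` down to the block `0, …, m - 1`. Its
-- entries lie in `A`, so `φ` and `ψ` can be applied entrywise, through `M_m(B)`; then `[T_pq] ↦ m⁻¹
-- ∑ W^p T_pq W^{-q}` maps back, where `W` represents the canonical unitary. On `x u^k` an exact `ψ
-- ∘ φ` would return the fraction of indices `p` for which `p - k` stays in the block, which is at
-- least `1 - |k|/m`. Since such monomials span a dense subspace, a large fixed `m` handles a finite
-- set and all its translates at once (`exists_approximation`).
--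
-- The cost of the block is controlled in `re_matTrace_exp_le`. The orbit sum `s` of `a` compresses
-- to the diagonal matrix with entries `θ^{-i}(s)`, and telescoping gives `‖θ^{-i}(s) - s‖ ≤ 2i‖a‖`,
-- uniformly in `n`. Monotonicity of `Tr e^h` (`IsCanonicalTrace.re_exp_le`) then bounds the new
-- partition function by `m e^{2m‖a‖}` times the old one. The trace used on `M_m(B)` is the
-- canonical one by `IsCanonicalTrace.matTrace`.

universe u v w

/-! ### Positive matrices, described algebraically -/

section MatrixPos

variable {A : Type*} {B : Type*} {N N' : Type*} [Fintype N] [Fintype N']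

/-- A square matrix over a *-ring is positive if it is of the form `Xᴴ * X`. -/
def MatrixPos {A : Type*} {N : Type*} [Fintype N] [NonUnitalSemiring A] [Star A]
    (M : Matrix N N A) : Prop :=
  ∃ X : Matrix N N A, M = X.conjTranspose * X

theorem MatrixPos.reindex [NonUnitalSemiring A] [Star A] {M : Matrix N N A} (hM : MatrixPos M)
    (e : N ≃ N') : MatrixPos (M.submatrix e.symm e.symm) := by
  obtain ⟨X, rfl⟩ := hM
  exact ⟨X.submatrix e.symm e.symm, by
    rw [Matrix.conjTranspose_submatrix, Matrix.submatrix_mul_equiv]⟩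

theorem matrixPos_submatrix_iff [NonUnitalSemiring A] [Star A] {M : Matrix N N A} (e : N' ≃ N) :
    MatrixPos (M.submatrix e e) ↔ MatrixPos M :=
  ⟨fun h => by simpa using h.reindex e, fun h => by simpa using h.reindex e.symm⟩

/-- Flattening blocks is a *-isomorphism `M_N(M_N'(A)) ≅ M_{N×N'}(A)`. It reduces complete
positivity of a map into or out of a matrix algebra to positivity of matrices over the coefficients.
-/
theorem matrixPos_comp_iff [NonUnitalSemiring A] [StarRing A] (M : Matrix N N (Matrix N' N' A)) :
    MatrixPos (Matrix.comp N N N' N' A M) ↔ MatrixPos M := by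
  have key : ∀ X : Matrix N N (Matrix N' N' A), Matrix.comp N N N' N' A (X.conjTranspose * X) =
      (Matrix.comp N N N' N' A X).conjTranspose * Matrix.comp N N N' N' A X := by
    intro X
    ext ⟨i, p⟩ ⟨j, q⟩
    change (X.conjTranspose * X) i j p q = ∑ x : N × N', star (X x.1 i x.2 p) * X x.1 j x.2 q
    simp [Matrix.mul_apply, Matrix.sum_apply, Fintype.sum_prod_type, Matrix.star_apply]
  constructor
  · rintro ⟨X, hX⟩
    refine ⟨(Matrix.comp N N N' N' A).symm X, (Matrix.comp N N N' N' A).injective ?_⟩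
    rw [key, hX, Equiv.apply_symm_apply]
  · rintro ⟨X, rfl⟩
    exact ⟨_, key X⟩

theorem MatrixPos.map [NonUnitalSemiring A] [Star A] [NonUnitalSemiring B] [Star B]
    {F : Type*} [FunLike F A B] [NonUnitalRingHomClass F A B] [StarHomClass F A B] (f : F)
    {M : Matrix N N A} (hM : MatrixPos M) : MatrixPos (M.map f) := by
  obtain ⟨X, rfl⟩ := hM
  refine ⟨X.map f, ?_⟩
  ext i j
  simp [Matrix.mul_apply, map_star]

theorem nonneg_iff_exists_star_mul_self [CStarAlgebra A] [PartialOrder A] [StarOrderedRing A]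
    (x : A) : 0 ≤ x ↔ ∃ y : A, x = star y * y :=
  CStarAlgebra.nonneg_iff_eq_star_mul_self

theorem nonneg_iff_matrixPos [CStarAlgebra A] [PartialOrder A] [StarOrderedRing A]
    (M : CStarMatrix N N A) : 0 ≤ M ↔ MatrixPos (CStarMatrix.ofMatrix.symm M) := by
  classical
  exact nonneg_iff_exists_star_mul_self M

end MatrixPos

/-- Nonnegativity in a C*-algebra means being of the form `y* y`, so the order can be eliminated.
All later complete positivity arguments work with this order-free criterion. -/
theorem isUCP_iff {A : Type u} {B : Type v} [CStarAlgebra A] [CStarAlgebra B] (φ : A →ₗ[ℂ] B) :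
    IsUCP φ ↔ φ 1 = 1 ∧ ∀ (k : ℕ) (M : Matrix (Fin k) (Fin k) A), MatrixPos M →
      MatrixPos (M.map φ) := by
  let _ := CStarAlgebra.spectralOrder A
  let _ := CStarAlgebra.spectralOrder B
  have _ := CStarAlgebra.spectralOrderedRing A
  have _ := CStarAlgebra.spectralOrderedRing B
  refine and_congr Iff.rfl ⟨?_, fun h => ?_⟩
  · rintro ⟨Φ, rfl⟩ k M hM
    exact (nonneg_iff_matrixPos _).1
      (Φ.map_cstarMatrix_nonneg' k (CStarMatrix.ofMatrix M) ((nonneg_iff_matrixPos _).2 hM))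
  · exact ⟨⟨φ, fun k M hM => (nonneg_iff_matrixPos _).2
      (h k _ ((nonneg_iff_matrixPos _).1 hM))⟩, rfl⟩

theorem IsUCP.matrixPos {A : Type u} {B : Type v} [CStarAlgebra A] [CStarAlgebra B]
    {φ : A →ₗ[ℂ] B} (h : IsUCP φ) {N : Type*} [Fintype N] {M : Matrix N N A} (hM : MatrixPos M) :
    MatrixPos (M.map φ) := by
  let e := Fintype.equivFin N
  rw [← matrixPos_submatrix_iff e.symm]
  exact ((isUCP_iff φ).1 h).2 _ _ (hM.reindex e)

theorem IsUCP.comp {A : Type u} {B : Type v} {C : Type w} [CStarAlgebra A] [CStarAlgebra B]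
    [CStarAlgebra C] {ψ : B →ₗ[ℂ] C} {φ : A →ₗ[ℂ] B} (hψ : IsUCP ψ) (hφ : IsUCP φ) :
    IsUCP (ψ ∘ₗ φ) := by
  refine (isUCP_iff _).2 ⟨?_, fun k M hM => hψ.matrixPos (hφ.matrixPos hM)⟩
  rw [LinearMap.comp_apply, hφ.1, hψ.1]

theorem isUCP_starAlgHom {A : Type u} {B : Type v} [CStarAlgebra A] [CStarAlgebra B]
    (f : A →⋆ₐ[ℂ] B) : IsUCP (f : A →ₗ[ℂ] B) :=
  (isUCP_iff _).2 ⟨map_one f, fun _ _ hM => hM.map f⟩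

/-- An injective *-homomorphism reflects positivity. -/
theorem nonneg_of_map_nonneg {A : Type u} {B : Type v} [CStarAlgebra A] [CStarAlgebra B]
    [PartialOrder A] [StarOrderedRing A] [PartialOrder B] [StarOrderedRing B]
    (f : A →⋆ₐ[ℂ] B) (hf : Function.Injective f) {x : A} (hx : 0 ≤ f x) : 0 ≤ x := by
  have hsa : IsSelfAdjoint x := by
    have := hx.isSelfAdjoint
    rw [IsSelfAdjoint, ← map_star] at this
    exact hf this
  rw [StarOrderedRing.nonneg_iff_spectrum_nonneg (R := ℝ) x hsa, ← hsa.map_spectrum_real f hf,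
    ← StarOrderedRing.nonneg_iff_spectrum_nonneg (R := ℝ) (f x) hx.isSelfAdjoint]
  exact hx

/-- The matrix algebra over a C*-algebra, with the C*-structure coming from the spectral order. -/
abbrev MatAlg (N : Type w) [Fintype N] [DecidableEq N] (A : Type u) : Type (max u w) :=
  CStarMatrix N N A

instance matAlgCStar (N : Type w) [Fintype N] [DecidableEq N] (A : Type u) [CStarAlgebra A] :
    CStarAlgebra (MatAlg N A) := by
  letI := CStarAlgebra.spectralOrder A
  letI := CStarAlgebra.spectralOrderedRing A
  exact inferInstanceAs (CStarAlgebra (CStarMatrix N N A))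

/-- Entrywise application of a *-homomorphism. -/
def matMapHom (N : Type w) [Fintype N] [DecidableEq N] {A : Type u} {B : Type v} [CStarAlgebra A]
    [CStarAlgebra B] (f : A →⋆ₐ[ℂ] B) : MatAlg N A →⋆ₐ[ℂ] MatAlg N B where
  toFun M := M.map f
  map_one' := by
    ext i j
    simp [CStarMatrix.one_apply, apply_ite f]
  map_mul' M M' := by
    ext i j
    simp [CStarMatrix.mul_apply]
  map_zero' := by ext i j; simp
  map_add' M M' := by ext i j; simp
  commutes' c := by
    ext i j
    simp [Algebra.algebraMap_eq_smul_one, CStarMatrix.one_apply, apply_ite f]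
  map_star' M := by
    ext i j
    simp [CStarMatrix.star_apply, map_star]

/-! ### Criteria for complete positivity, and norm bounds for ucp maps -/

section Positivity

variable {A : Type u} {B : Type v} [CStarAlgebra A] [CStarAlgebra B]
  {N : Type w} [Fintype N]

theorem matrixPos_of_map (f : A →⋆ₐ[ℂ] B) (hf : Function.Injective f) {M : Matrix N N A}
    (hM : MatrixPos (M.map f)) : MatrixPos M := by
  classical
  let _ := CStarAlgebra.spectralOrder A
  let _ := CStarAlgebra.spectralOrder B
  have _ := CStarAlgebra.spectralOrderedRing A
  have _ := CStarAlgebra.spectralOrderedRing B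
  let _ := CStarAlgebra.spectralOrder (MatAlg N A)
  let _ := CStarAlgebra.spectralOrder (MatAlg N B)
  have _ := CStarAlgebra.spectralOrderedRing (MatAlg N A)
  have _ := CStarAlgebra.spectralOrderedRing (MatAlg N B)
  have hinj : Function.Injective (matMapHom N f) := CStarMatrix.map_injective hf
  have h0 : 0 ≤ matMapHom N f (CStarMatrix.ofMatrix M) :=
    (nonneg_iff_exists_star_mul_self (A := MatAlg N B) _).2 hM
  exact (nonneg_iff_exists_star_mul_self (A := MatAlg N A) _).1 (nonneg_of_map_nonneg _ hinj h0)

variable {H : Type*} [NormedAddCommGroup H] [InnerProductSpace ℂ H]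

/-- A matrix of operators on `H` as an operator on the direct sum `H^N`. -/
def matToOpL (M : CStarMatrix N N (H →L[ℂ] H)) :
    PiLp 2 (fun _ : N => H) →L[ℂ] PiLp 2 (fun _ : N => H) :=
  ((PiLp.continuousLinearEquiv 2 ℂ (fun _ : N => H)).symm : _ →L[ℂ] _) ∘L
    ContinuousLinearMap.pi fun i => ∑ j, (M i j) ∘L PiLp.proj 2 (fun _ : N => H) j

theorem matToOpL_apply (M : CStarMatrix N N (H →L[ℂ] H)) (ξ : PiLp 2 (fun _ : N => H)) (i : N) :
    matToOpL M ξ i = ∑ j, M i j (ξ j) := by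
  simp [matToOpL]

theorem inner_matToOpL (M : CStarMatrix N N (H →L[ℂ] H)) (ξ η : PiLp 2 (fun _ : N => H)) :
    ⟪ξ, matToOpL M η⟫_ℂ = ∑ i, ∑ j, ⟪ξ i, M i j (η j)⟫_ℂ := by
  simp [PiLp.inner_apply, matToOpL_apply, inner_sum]

/-- The matrix algebra over `B(H)` acting on the direct sum `H^N`. -/
def matToOp (N : Type w) [Fintype N] [DecidableEq N] (H : Type*) [NormedAddCommGroup H]
    [InnerProductSpace ℂ H] [CompleteSpace H] : MatAlg N (H →L[ℂ] H) →⋆ₐ[ℂ]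
      (PiLp 2 (fun _ : N => H) →L[ℂ] PiLp 2 (fun _ : N => H)) where
  toFun M := matToOpL M
  map_one' := by
    ext ξ i
    rw [matToOpL_apply, Finset.sum_eq_single i]
    · simp
    · intro j _ hj
      rw [CStarMatrix.one_apply_ne' hj]; simp
    · simp
  map_mul' M M' := by
    ext ξ i
    simp only [matToOpL_apply, CStarMatrix.mul_apply, mul_apply_eq_comp,
      _root_.sum_apply, map_sum]
    exact Finset.sum_comm
  map_zero' := by
    ext ξ i
    simp [matToOpL_apply]
  map_add' M M' := by
    ext ξ i
    simp [matToOpL_apply, Finset.sum_add_distrib]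
  commutes' c := by
    ext ξ i
    rw [matToOpL_apply, Finset.sum_eq_single i]
    · simp [Algebra.algebraMap_eq_smul_one]
    · intro j _ hj
      rw [Algebra.algebraMap_eq_smul_one, CStarMatrix.smul_apply, CStarMatrix.one_apply_ne' hj]
      simp
    · simp
  map_star' M := by
    rw [ContinuousLinearMap.star_eq_adjoint, ContinuousLinearMap.eq_adjoint_iff]
    intro ξ η
    rw [← inner_conj_symm, inner_matToOpL, inner_matToOpL, map_sum]
    simp_rw [map_sum, inner_conj_symm]
    rw [Finset.sum_comm]
    refine Finset.sum_congr rfl fun i _ => Finset.sum_congr rfl fun j _ => ?_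
    rw [CStarMatrix.star_apply, ContinuousLinearMap.star_eq_adjoint,
      ContinuousLinearMap.adjoint_inner_left]

open scoped ComplexOrder

theorem op_nonneg_iff (T : H →L[ℂ] H) : 0 ≤ T ↔ ∀ ξ, 0 ≤ ⟪ξ, T ξ⟫_ℂ := by
  rw [ContinuousLinearMap.nonneg_iff_isPositive, ContinuousLinearMap.isPositive_iff_complex]
  refine forall_congr' fun ξ => ?_
  rw [← inner_conj_symm ξ, RCLike.nonneg_iff (K := ℂ)]
  simp only [RCLike.re_eq_complex_re, RCLike.im_eq_complex_im, Complex.conj_re, Complex.conj_im,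
    neg_eq_zero]
  rw [and_comm]
  refine and_congr Iff.rfl ⟨fun h => ?_, fun h => ?_⟩
  · rw [← h]; simp
  · exact Complex.ext (by simp) (by simp [h])

variable [CompleteSpace H]

/-- The matrix algebra over `B(H)` acts faithfully on `H^N`, and an injective *-homomorphism
reflects positivity; there positivity is that of the quadratic form. The inequality in `ℂ` also
asserts that the form is real. -/
theorem matrixPos_op_iff (M : Matrix N N (H →L[ℂ] H)) :
    MatrixPos M ↔ ∀ ξ : N → H, 0 ≤ ∑ i, ∑ j, ⟪ξ i, M i j (ξ j)⟫_ℂ := by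
  classical
  let _ := CStarAlgebra.spectralOrder (MatAlg N (H →L[ℂ] H))
  have _ := CStarAlgebra.spectralOrderedRing (MatAlg N (H →L[ℂ] H))
  have hinj : Function.Injective (matToOp N H) := by
    rw [injective_iff_map_eq_zero]
    intro M hM
    ext i j x
    have := congrArg (fun ξ : PiLp 2 (fun _ : N => H) => ξ i)
      (congrArg (fun T => T (WithLp.toLp 2 (Pi.single j x))) hM)
    change matToOpL M _ i = _ at this
    rw [matToOpL_apply, Finset.sum_eq_single j] at this
    · simpa using this
    · intro k _ hk
      simp [hk]
    · simp
  have h1 : MatrixPos M ↔ 0 ≤ matToOp N H (CStarMatrix.ofMatrix M) := by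
    refine ⟨fun h => ?_, fun h => ?_⟩
    · exact map_nonneg _ ((nonneg_iff_exists_star_mul_self (A := MatAlg N (H →L[ℂ] H)) _).2 h)
    · exact (nonneg_iff_exists_star_mul_self (A := MatAlg N (H →L[ℂ] H)) _).1
        (nonneg_of_map_nonneg _ hinj h)
  rw [h1, op_nonneg_iff]
  refine ⟨fun h ξ => ?_, fun h ξ => ?_⟩
  · have := h (WithLp.toLp 2 ξ)
    exact this.trans_eq (inner_matToOpL _ _ _)
  · exact (h ξ).trans_eq (inner_matToOpL _ _ _).symm

/-- A criterion for complete positivity of maps into `B(H)`. -/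
theorem isUCP_of_inner (f : A →ₗ[ℂ] (H →L[ℂ] H)) (h1 : f 1 = 1)
    (h : ∀ (k : ℕ) (a : Fin k → A) (ξ : Fin k → H),
      0 ≤ ∑ i, ∑ j, ⟪ξ i, f (star (a i) * a j) (ξ j)⟫_ℂ) : IsUCP f := by
  refine (isUCP_iff f).2 ⟨h1, ?_⟩
  rintro k _ ⟨X, rfl⟩
  rw [matrixPos_op_iff]
  intro ξ
  -- Each row of `X` contributes a matrix `(a_i* a_j)`, so `X* X` is a sum of matrices of the form
  -- treated in `h`.
  have : ∑ i, ∑ j, ⟪ξ i, ((X.conjTranspose * X).map f) i j (ξ j)⟫_ℂ =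
      ∑ l, ∑ i, ∑ j, ⟪ξ i, f (star (X l i) * X l j) (ξ j)⟫_ℂ := by
    simp only [Matrix.map_apply, Matrix.mul_apply, Matrix.conjTranspose_apply, map_sum,
      _root_.sum_apply, inner_sum]
    rw [eq_comm, Finset.sum_comm]
    exact Finset.sum_congr rfl fun i _ => Finset.sum_comm
  rw [this]
  exact Finset.sum_nonneg fun l _ => h k (X l) ξ

theorem IsUCP.map_nonneg [PartialOrder A] [StarOrderedRing A] [PartialOrder B] [StarOrderedRing B]
    {φ : A →ₗ[ℂ] B} (hφ : IsUCP φ) {x : A} (hx : 0 ≤ x) : 0 ≤ φ x := by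
  obtain ⟨y, rfl⟩ := (nonneg_iff_exists_star_mul_self x).1 hx
  obtain ⟨Y, hY⟩ := hφ.matrixPos (N := Unit) (M := Matrix.of fun _ _ => star y * y)
    ⟨Matrix.of fun _ _ => y, by ext; simp [Matrix.mul_apply]⟩
  refine (nonneg_iff_exists_star_mul_self _).2 ⟨Y () (), ?_⟩
  have := congrFun (congrFun hY ()) ()
  simpa [Matrix.mul_apply] using this

theorem IsUCP.map_star {φ : A →ₗ[ℂ] B} (hφ : IsUCP φ) (x : A) : φ (star x) = star (φ x) := by
  let _ := CStarAlgebra.spectralOrder A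
  let _ := CStarAlgebra.spectralOrder B
  have _ := CStarAlgebra.spectralOrderedRing A
  have _ := CStarAlgebra.spectralOrderedRing B
  let p : A →ₚ[ℂ] B := PositiveLinearMap.mk₀ φ fun x hx => hφ.map_nonneg hx
  exact StarHomClass.map_star p x

theorem IsUCP.map_algebraMap {φ : A →ₗ[ℂ] B} (hφ : IsUCP φ) (r : ℝ) :
    φ (algebraMap ℝ A r) = algebraMap ℝ B r := by
  rw [Algebra.algebraMap_eq_smul_one, Algebra.algebraMap_eq_smul_one, ← Complex.coe_smul,
    map_smul, hφ.1, Complex.coe_smul]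

theorem IsUCP.norm_le_of_isSelfAdjoint {φ : A →ₗ[ℂ] B} (hφ : IsUCP φ) {x : A}
    (hx : IsSelfAdjoint x) : ‖φ x‖ ≤ ‖x‖ := by
  let _ := CStarAlgebra.spectralOrder A
  let _ := CStarAlgebra.spectralOrder B
  have _ := CStarAlgebra.spectralOrderedRing A
  have _ := CStarAlgebra.spectralOrderedRing B
  have hy : IsSelfAdjoint (φ x) := by rw [IsSelfAdjoint, ← hφ.map_star, hx.star_eq]
  have h1 : φ x ≤ algebraMap ℝ B ‖x‖ := by
    rw [← sub_nonneg, ← hφ.map_algebraMap, ← map_sub]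
    exact hφ.map_nonneg (sub_nonneg.2 hx.le_algebraMap_norm_self)
  have h2 : -algebraMap ℝ B ‖x‖ ≤ φ x := by
    rw [← sub_nonneg, ← hφ.map_algebraMap, ← map_neg, ← map_sub]
    exact hφ.map_nonneg (sub_nonneg.2 hx.neg_algebraMap_norm_le_self)
  rw [← map_neg, algebraMap_le_iff_le_spectrum (a := φ x) (ha := hy)] at h2
  rw [le_algebraMap_iff_spectrum_le (a := φ x) (ha := hy)] at h1
  rw [← cfc_id ℝ (φ x) hy]
  exact norm_cfc_le (norm_nonneg x) fun t ht => abs_le.2 ⟨h2 t ht, h1 t ht⟩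

/-- Splitting into real and imaginary parts reduces this to the self-adjoint case. The constant 2,
rather than the sharp 1, is harmless: it is absorbed by using `δ / 2` later. -/
theorem IsUCP.norm_le {φ : A →ₗ[ℂ] B} (hφ : IsUCP φ) (x : A) : ‖φ x‖ ≤ 2 * ‖x‖ := by
  have h : φ x = φ (realPart x : A) + Complex.I • φ (imaginaryPart x : A) := by
    rw [← map_smul, ← map_add, realPart_add_I_smul_imaginaryPart]
  rw [h, two_mul]
  refine (norm_add_le _ _).trans (add_le_add ?_ ?_)
  · exact (hφ.norm_le_of_isSelfAdjoint (realPart x).2).trans (realPart.norm_le x)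
  · rw [norm_smul, Complex.norm_I, one_mul]
    exact (hφ.norm_le_of_isSelfAdjoint (imaginaryPart x).2).trans (imaginaryPart.norm_le x)

/-- Entrywise application of a ucp map is ucp. -/
def matMapLin (N : Type w) [Fintype N] [DecidableEq N] (φ : A →ₗ[ℂ] B) :
    MatAlg N A →ₗ[ℂ] MatAlg N B where
  toFun M := CStarMatrix.map M φ
  map_add' M M' := by ext; simp
  map_smul' c M := by ext; simp

theorem IsUCP.matMapLin {φ : A →ₗ[ℂ] B} (hφ : IsUCP φ) (N : Type w) [Fintype N] [DecidableEq N] :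
    IsUCP (matMapLin N φ) := by
  refine (isUCP_iff _).2 ⟨?_, fun k M hM => ?_⟩
  · ext i j
    change φ ((1 : CStarMatrix N N A) i j) = _
    rw [CStarMatrix.one_apply, CStarMatrix.one_apply, apply_ite φ, hφ.1, map_zero]
  · have h := hφ.matrixPos ((matrixPos_comp_iff (A := A) M).2 hM)
    exact (matrixPos_comp_iff (A := B) (M.map (CStarPressure.matMapLin N φ))).1 h

/-- The map `[T p q] ↦ ∑ S_p* T_{pq} S_q`. -/
def rowCompress [DecidableEq N] (S : N → H →L[ℂ] H) : MatAlg N (H →L[ℂ] H) →ₗ[ℂ] (H →L[ℂ] H) where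
  toFun M := ∑ p, ∑ q, star (S p) * (show CStarMatrix N N (H →L[ℂ] H) from M) p q * S q
  map_add' M M' := by
    rw [← Finset.sum_add_distrib]
    refine Finset.sum_congr rfl fun p _ => ?_
    rw [← Finset.sum_add_distrib]
    refine Finset.sum_congr rfl fun q _ => ?_
    rw [← add_mul, ← mul_add]
    rfl
  map_smul' c M := by
    rw [Finset.smul_sum]
    refine Finset.sum_congr rfl fun p _ => ?_
    rw [Finset.smul_sum]
    refine Finset.sum_congr rfl fun q _ => ?_
    rw [RingHom.id_apply, ← smul_mul_assoc, ← mul_smul_comm]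
    rfl

/-- The hypothesis says that the column `(S_p)` is an isometry `H → H^N`; the map is compression by
it. -/
theorem isUCP_rowCompress [DecidableEq N] (S : N → H →L[ℂ] H) (hS : ∑ p, star (S p) * S p = 1) :
    IsUCP (rowCompress S) := by
  refine (isUCP_iff _).2 ⟨?_, fun k M hM => ?_⟩
  · rw [← hS]
    refine Finset.sum_congr rfl fun p _ => ?_
    rw [Finset.sum_eq_single p]
    · change star (S p) * (1 : CStarMatrix N N (H →L[ℂ] H)) p p * S p = _
      rw [CStarMatrix.one_apply_eq, mul_one]
    · intro q _ hq
      change star (S p) * (1 : CStarMatrix N N (H →L[ℂ] H)) p q * S q = _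
      rw [CStarMatrix.one_apply_ne' hq, mul_zero, zero_mul]
    · simp
  · rw [matrixPos_op_iff]
    intro ξ
    have h := (matrixPos_op_iff _).1 ((matrixPos_comp_iff (A := H →L[ℂ] H) M).2 hM)
      fun ip => S ip.2 (ξ ip.1)
    refine h.trans_eq ?_
    rw [Fintype.sum_prod_type]
    simp_rw [Fintype.sum_prod_type]
    refine Finset.sum_congr rfl fun i _ => ?_
    rw [Finset.sum_comm]
    refine Finset.sum_congr rfl fun j _ => ?_
    change _ = ⟪ξ i, (∑ p, ∑ q, star (S p) * (M i j : CStarMatrix N N (H →L[ℂ] H)) p q * S q)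
      (ξ j)⟫_ℂ
    simp only [_root_.sum_apply, inner_sum, mul_apply_eq_comp]
    refine Finset.sum_congr rfl fun p _ => Finset.sum_congr rfl fun q _ => ?_
    rw [ContinuousLinearMap.star_eq_adjoint, ContinuousLinearMap.adjoint_inner_right]
    rfl

/-- A block compression of a representation is ucp. -/
theorem isUCP_of_compress {L : Type*} [NormedAddCommGroup L] [InnerProductSpace ℂ L]
    [CompleteSpace L] [DecidableEq N] (π : A →⋆ₐ[ℂ] (H →L[ℂ] H)) (hπ : Function.Injective π)
    (σ : B →⋆ₐ[ℂ] (L →L[ℂ] L)) (J : N → H →L[ℂ] L)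
    (hJ : ∀ p q (ξ η : H), ⟪J p ξ, J q η⟫_ℂ = if p = q then ⟪ξ, η⟫_ℂ else 0)
    (E : B →ₗ[ℂ] MatAlg N A)
    (hE : ∀ z p q ξ η, ⟪ξ, π ((show CStarMatrix N N A from E z) p q) η⟫_ℂ = ⟪J p ξ, σ z (J q η)⟫_ℂ) :
    IsUCP E := by
  refine (isUCP_iff _).2 ⟨?_, fun k M hM => ?_⟩
  · ext p q
    apply hπ
    ext η
    refine ext_inner_left ℂ fun ξ => ?_
    refine (hE 1 p q ξ η).trans ?_
    rw [map_one, one_apply_eq_self, hJ, CStarMatrix.one_apply, apply_ite π, map_one, map_zero]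
    split_ifs <;> simp
  · refine (matrixPos_comp_iff (A := A) (M.map E)).1 (matrixPos_of_map π hπ ?_)
    rw [matrixPos_op_iff]
    intro ξ
    -- The `J p` are isometries with orthogonal ranges, so together they embed `H^N` isometrically
    -- in `L`. The quadratic form of `E` is that of `σ` on vectors of this subspace.
    have h := (matrixPos_op_iff _).1 (hM.map σ) fun i => ∑ p, J p (ξ (i, p))
    refine h.trans_eq ?_
    rw [Fintype.sum_prod_type]
    simp_rw [Fintype.sum_prod_type]
    refine Finset.sum_congr rfl fun i _ => ?_
    rw [Finset.sum_comm]
    refine Finset.sum_congr rfl fun j _ => ?_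
    simp only [map_sum, sum_inner, inner_sum]
    rw [Finset.sum_comm]
    refine Finset.sum_congr rfl fun p _ => Finset.sum_congr rfl fun q _ => ?_
    exact (hE _ _ _ _ _).symm

end Positivity

/-! ### Spectral projections in finite dimension -/

section SpectralProjection

variable {B : Type u} [CStarAlgebra B] [FiniteDimensional ℂ B]

theorem finite_spectrum_real (h : B) : (spectrum ℝ h).Finite := by
  have : FiniteDimensional ℝ B := FiniteDimensional.complexToReal B
  rcases subsingleton_or_nontrivial B with hB | hB
  · rw [spectrum.of_subsingleton]
    exact Set.finite_empty
  refine ((minpoly ℝ h).rootSet_finite ℝ).subset fun r hr => ?_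
  have hm := spectrum.subset_polynomial_aeval h (minpoly ℝ h) ⟨r, hr, rfl⟩
  rw [minpoly.aeval, spectrum.zero_eq, Set.mem_singleton_iff] at hm
  rw [Polynomial.mem_rootSet]
  exact ⟨minpoly.ne_zero (Algebra.IsIntegral.isIntegral h), by simpa using hm⟩

/-- The spectrum is finite, so every function is continuous on it. This makes the functional
calculus available for indicators of points. -/
theorem continuousOn_spectrum_real (h : B) (f : ℝ → ℝ) : ContinuousOn f (spectrum ℝ h) :=
  (finite_spectrum_real h).continuousOn f

/-- The spectral projection of `h` at the real number `r`. -/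
def specProj (h : B) (r : ℝ) : B := cfc (fun t : ℝ => if t = r then 1 else 0) h

theorem isStarProjection_specProj (h : B) (r : ℝ) : IsStarProjection (specProj h r) := by
  refine ⟨?_, cfc_predicate _ _⟩
  rw [IsIdempotentElem, specProj, ← cfc_mul _ _ h (continuousOn_spectrum_real h _)
    (continuousOn_spectrum_real h _)]
  congr 1
  ext t
  simp

theorem mul_specProj {h : B} (hh : IsSelfAdjoint h) (r : ℝ) :
    h * specProj h r = r • specProj h r := by
  have : cfc (fun t : ℝ => t) h * specProj h r = r • specProj h r := by
    rw [specProj, ← cfc_mul _ _ h (continuousOn_spectrum_real h _)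
      (continuousOn_spectrum_real h _), ← cfc_smul _ _ h (continuousOn_spectrum_real h _)]
    congr 1
    ext t
    by_cases ht : t = r <;> simp [ht]
  rwa [cfc_id' ℝ h hh] at this

theorem cfc_eq_sum_specProj (h : B) (f : ℝ → ℝ) :
    cfc f h = ∑ r ∈ (finite_spectrum_real h).toFinset, f r • specProj h r := by
  simp_rw [specProj, ← cfc_smul _ _ h (continuousOn_spectrum_real h _)]
  rw [← cfc_sum _ h _ fun _ _ => continuousOn_spectrum_real h _]
  refine cfc_congr fun t ht => ?_
  rw [Finset.sum_apply, Finset.sum_eq_single t]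
  · simp
  · intro r _ hr
    simp [hr.symm]
  · intro h'
    exact absurd ((finite_spectrum_real h).mem_toFinset.2 ht) h'

theorem sum_specProj {h : B} (hh : IsSelfAdjoint h) :
    ∑ r ∈ (finite_spectrum_real h).toFinset, specProj h r = 1 := by
  have := cfc_eq_sum_specProj h fun _ => 1
  rw [cfc_const_one ℝ h hh] at this
  simpa using this.symm

theorem specProj_ne_zero {h : B} (hh : IsSelfAdjoint h) {r : ℝ} (hr : r ∈ spectrum ℝ h) :
    specProj h r ≠ 0 := by
  intro h0
  rw [specProj, ← cfc_zero ℝ h] at h0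
  have := eqOn_of_cfc_eq_cfc h0 (continuousOn_spectrum_real h _) (continuousOn_spectrum_real h _)
    hh hr
  simp at this

/-- A self-adjoint element below a minimal projection is a multiple of it. -/
theorem IsMinimalProjection.exists_smul_eq {e x : B} (he : IsMinimalProjection e)
    (hx : IsSelfAdjoint x) (hex : e * x = x) : ∃ r : ℝ, x = r • e := by
  have hxe : x * e = x := by
    have := congrArg star hex
    rwa [star_mul, hx.star_eq, he.1.2.star_eq] at this
  -- A spectral projection of `x` at a nonzero point lies below `e`, since it is a multiple of `x`
  -- times itself; minimality makes it equal to `e`.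
  have key : ∀ r ∈ spectrum ℝ x, r ≠ 0 → specProj x r = e := by
    intro r hr hr0
    refine (he.2.2 _ (isStarProjection_specProj x r) ?_).resolve_left (specProj_ne_zero hx hr)
    have h1 := mul_specProj hx r
    have h2 : specProj x r = r⁻¹ • (x * specProj x r) := by
      rw [h1, smul_smul, inv_mul_cancel₀ hr0, one_smul]
    rw [h2, mul_smul_comm, ← mul_assoc, hex]
  by_cases h : ∃ r ∈ spectrum ℝ x, r ≠ 0
  · obtain ⟨r, hr, hr0⟩ := h
    refine ⟨r, ?_⟩
    rw [← key r hr hr0, ← mul_specProj hx, key r hr hr0, hxe]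
  · push Not at h
    refine ⟨0, ?_⟩
    rw [zero_smul, ← cfc_id' ℝ x hx, cfc_congr (g := fun _ => 0) fun t ht => h t ht]
    exact cfc_const_zero ℝ x

end SpectralProjection

/-! ### Positivity of the canonical trace and monotonicity of `Tr e^h` -/

section Trace

variable {B : Type u} [CStarAlgebra B]

theorem apply_real_smul (τ : B →ₗ[ℂ] ℂ) (r : ℝ) (x : B) : τ (r • x) = r * τ x := by
  rw [← Complex.coe_smul, map_smul, smul_eq_mul]

theorem map_real_smul (τ : B →ₗ[ℂ] ℂ) (r : ℝ) (x : B) : (τ (r • x)).re = r * (τ x).re := by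
  rw [apply_real_smul, Complex.re_ofReal_mul]

variable [FiniteDimensional ℂ B]

/-- Every projection has nonnegative trace. -/
theorem IsCanonicalTrace.re_projection_nonneg {τ : B →ₗ[ℂ] ℂ} (hτ : IsCanonicalTrace τ) {p : B}
    (hp : IsStarProjection p) : 0 ≤ (τ p).re := by
  -- Induction on the dimension of the right ideal `pB`: a nonzero projection that is not minimal
  -- splits as `f + (p - f)`, and both summands generate strictly smaller right ideals.
  induction hn : Module.finrank ℂ (LinearMap.range (LinearMap.mulLeft ℂ p)) using
    Nat.strong_induction_on generalizing p with
  | _ n ih =>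
  subst hn
  by_cases h0 : p = 0
  · simp [h0]
  by_cases hmin : IsMinimalProjection p
  · rw [hτ.2 p hmin]; simp
  have : ∃ f : B, IsStarProjection f ∧ p * f = f ∧ f ≠ 0 ∧ f ≠ p := by
    by_contra hcon
    refine hmin ⟨hp, h0, fun f hf hpf => ?_⟩
    by_contra hne
    push Not at hne
    exact hcon ⟨f, hf, hpf, hne⟩
  obtain ⟨f, hf, hpf, hf0, hfp⟩ := this
  have hfp' : f * p = f := by
    have := congrArg star hpf
    rwa [star_mul, hf.2.star_eq, hp.2.star_eq] at this
  have step : ∀ g : B, IsStarProjection g → p * g = g → g * p = g → g ≠ p → 0 ≤ (τ g).re := by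
    intro g hg hpg hgp hne
    refine ih _ (Submodule.finrank_lt_finrank_of_lt (lt_of_le_of_ne ?_ ?_)) hg rfl
    · rintro _ ⟨x, rfl⟩
      exact ⟨g * x, by simp [← mul_assoc, hpg]⟩
    · intro heq
      have hmem : p ∈ LinearMap.range (LinearMap.mulLeft ℂ p) := ⟨1, by simp⟩
      rw [← heq] at hmem
      obtain ⟨x, hx⟩ := hmem
      rw [LinearMap.mulLeft_apply] at hx
      apply hne
      rw [← hgp, ← hx, ← mul_assoc, hg.1.eq]
  have hsub : IsStarProjection (p - f) := by
    refine ⟨?_, hp.2.sub hf.2⟩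
    rw [IsIdempotentElem, mul_sub, sub_mul, sub_mul, hpf, hfp', hf.1.eq, hp.1.eq]
    simp
  have h1 := step f hf hpf hfp' hfp
  have h2 := step (p - f) hsub (by rw [mul_sub, hp.1.eq, hpf]) (by rw [sub_mul, hp.1.eq, hfp'])
    (by simpa using hf0)
  have : τ p = τ f + τ (p - f) := by rw [← map_add]; congr 1; abel
  rw [this, Complex.add_re]
  exact add_nonneg h1 h2

variable [PartialOrder B] [StarOrderedRing B]

theorem IsCanonicalTrace.re_nonneg {τ : B →ₗ[ℂ] ℂ} (hτ : IsCanonicalTrace τ) {x : B}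
    (hx : 0 ≤ x) : 0 ≤ (τ x).re := by
  have hsa := hx.isSelfAdjoint
  have h : x = ∑ r ∈ (finite_spectrum_real x).toFinset, r • specProj x r := by
    conv_lhs => rw [← cfc_id' ℝ x hsa]
    exact cfc_eq_sum_specProj x _
  rw [h, map_sum, Complex.re_sum]
  refine Finset.sum_nonneg fun r hr => ?_
  rw [map_real_smul]
  refine mul_nonneg ?_ (hτ.re_projection_nonneg (isStarProjection_specProj x r))
  exact spectrum_nonneg_of_nonneg hx ((finite_spectrum_real x).mem_toFinset.1 hr)

theorem IsCanonicalTrace.re_projection_mul_nonneg {τ : B →ₗ[ℂ] ℂ} (hτ : IsCanonicalTrace τ)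
    {p x : B} (hp : IsStarProjection p) (hx : 0 ≤ x) : 0 ≤ (τ (p * x)).re := by
  have h : τ (p * x) = τ (star p * x * p) := by
    rw [hτ.1 _ p, ← mul_assoc, hp.2.star_eq, hp.1.eq]
  rw [h]
  exact hτ.re_nonneg (star_left_conjugate_nonneg hx p)

/-- Monotonicity of `Tr e^h`. -/
theorem IsCanonicalTrace.re_exp_le {τ : B →ₗ[ℂ] ℂ} (hτ : IsCanonicalTrace τ) {h k : B}
    (hh : IsSelfAdjoint h) (hk : IsSelfAdjoint k) (hhk : h ≤ k) :
    (τ (NormedSpace.exp h)).re ≤ (τ (NormedSpace.exp k)).re := by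
  rw [← CFC.real_exp_eq_normedSpace_exp hh, cfc_eq_sum_specProj h, map_sum, Complex.re_sum,
    ← one_mul (NormedSpace.exp k), ← sum_specProj hh, Finset.sum_mul, map_sum, Complex.re_sum]
  refine Finset.sum_le_sum fun r _ => ?_
  have hp := isStarProjection_specProj h r
  -- The exponential is not operator monotone, so `e^k` is compared with its tangent at each
  -- eigenvalue `r` of `h`. Multiplying by the spectral projection `p` of `h` and tracing gives
  -- `Tr(p e^k) ≥ e^r (Tr p + Tr(pk) - r Tr p)`, while `h ≤ k` gives `Tr(pk) ≥ Tr(ph) = r Tr p`.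
  -- Summing over `r` gives the claim.
  have htan : Real.exp r • (1 + k - algebraMap ℝ B r) ≤ NormedSpace.exp k := by
    have : cfc (fun t : ℝ => Real.exp r * (1 + t - r)) k ≤ cfc Real.exp k := by
      refine cfc_mono (fun t _ => ?_) (continuousOn_spectrum_real k _)
        (continuousOn_spectrum_real k _)
      have := Real.add_one_le_exp (t - r)
      calc Real.exp r * (1 + t - r) ≤ Real.exp r * Real.exp (t - r) := by
            gcongr; linarith
        _ = Real.exp t := by rw [← Real.exp_add]; congr 1; ring
    rw [CFC.real_exp_eq_normedSpace_exp hk] at this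
    refine le_of_eq_of_le ?_ this
    rw [cfc_const_mul _ _ _ (continuousOn_spectrum_real k _),
      cfc_sub _ _ _ (continuousOn_spectrum_real k _) (continuousOn_spectrum_real k _),
      cfc_add _ _ _ (continuousOn_spectrum_real k _) (continuousOn_spectrum_real k _),
      cfc_const_one ℝ k hk, cfc_id' ℝ k hk, cfc_const r k hk]
  have h1 := hτ.re_projection_mul_nonneg hp (sub_nonneg.2 htan)
  have h2 := hτ.re_projection_mul_nonneg hp (sub_nonneg.2 hhk)
  have h3 : τ (specProj h r * h) = τ (r • specProj h r) := by rw [hτ.1, mul_specProj hh]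
  rw [mul_sub, map_sub, Complex.sub_re, h3, map_real_smul] at h2
  rw [mul_sub, map_sub, Complex.sub_re, mul_smul_comm, map_real_smul, mul_sub, mul_add, mul_one,
    map_sub, map_add, Algebra.algebraMap_eq_smul_one, mul_smul_comm, mul_one, Complex.sub_re,
    Complex.add_re, map_real_smul] at h1
  rw [map_real_smul]
  nlinarith [Real.exp_pos r]

/-- Here `h ≤ k + c`, and the scalar `c` commutes with `k`, so it leaves the exponential as the
factor `e^c`. -/
theorem IsCanonicalTrace.re_exp_le_of_norm_sub_le {τ : B →ₗ[ℂ] ℂ} (hτ : IsCanonicalTrace τ)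
    {h k : B} (hh : IsSelfAdjoint h) (hk : IsSelfAdjoint k) {c : ℝ} (hc : ‖h - k‖ ≤ c) :
    (τ (NormedSpace.exp h)).re ≤ Real.exp c * (τ (NormedSpace.exp k)).re := by
  have hle : h ≤ k + algebraMap ℝ B c := by
    rw [← sub_le_iff_le_add']
    refine (hh.sub hk).le_algebraMap_norm_self.trans ?_
    exact algebraMap_mono B hc
  have hsa : IsSelfAdjoint (algebraMap ℝ B c) := .algebraMap B (.all c)
  refine (hτ.re_exp_le hh (hk.add hsa) hle).trans_eq ?_
  let _ : NormedAlgebra ℚ B := NormedAlgebra.restrictScalars ℚ ℝ B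
  rw [NormedSpace.exp_add_of_commute (Algebra.commutes' c k).symm, ← map_real_smul,
    ← NormedSpace.algebraMap_exp_comm, ← Algebra.commutes, ← Algebra.smul_def, Real.exp_eq_exp_ℝ]

end Trace

/-! ### The canonical trace on matrices over a finite-dimensional algebra -/

section MatTrace

variable {B : Type u} [CStarAlgebra B] {N : Type w} [Fintype N] [DecidableEq N]

instance [FiniteDimensional ℂ B] : FiniteDimensional ℂ (MatAlg N B) :=
  inferInstanceAs (FiniteDimensional ℂ (Matrix N N B))

/-- Block diagonal elements of the matrix algebra. -/
def matDiag (d : N → B) : MatAlg N B := CStarMatrix.ofMatrix (Matrix.diagonal d)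

theorem exp_matDiag (d : N → B) :
    NormedSpace.exp (matDiag d) = matDiag fun p => NormedSpace.exp (d p) := by
  let _ : NormedAlgebra ℚ B := NormedAlgebra.restrictScalars ℚ ℂ B
  exact (Matrix.exp_diagonal d).trans (congrArg Matrix.diagonal (funext (Pi.coe_exp d)))

/-- The trace on the matrix algebra induced by a trace on the coefficients. -/
def matTrace (N : Type w) [Fintype N] [DecidableEq N] (τ : B →ₗ[ℂ] ℂ) : MatAlg N B →ₗ[ℂ] ℂ where
  toFun M := ∑ p, τ ((show CStarMatrix N N B from M) p p)
  map_add' M M' := by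
    rw [← Finset.sum_add_distrib]
    refine Finset.sum_congr rfl fun p _ => ?_
    rw [← map_add]
    rfl
  map_smul' c M := by
    rw [RingHom.id_apply, Finset.smul_sum]
    refine Finset.sum_congr rfl fun p _ => ?_
    rw [← map_smul]
    rfl

theorem matTrace_matDiag (τ : B →ₗ[ℂ] ℂ) (d : N → B) : matTrace N τ (matDiag d) = ∑ p, τ (d p) :=
  Finset.sum_congr rfl fun p _ => congrArg τ (Matrix.diagonal_apply_eq d p)

theorem matTrace_mul_comm {τ : B →ₗ[ℂ] ℂ} (hτ : ∀ x y, τ (x * y) = τ (y * x))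
    (x y : MatAlg N B) : matTrace N τ (x * y) = matTrace N τ (y * x) := by
  change ∑ p, τ (∑ q, _ * _) = ∑ p, τ (∑ q, _ * _)
  simp_rw [map_sum]
  rw [Finset.sum_comm]
  exact Finset.sum_congr rfl fun p _ => Finset.sum_congr rfl fun q _ => hτ _ _

/-- The corner embedding `b ↦ e_{pp} ⊗ b`. -/
def matCorner (p : N) (b : B) : MatAlg N B := CStarMatrix.ofMatrix (Matrix.single p p b)

theorem matCorner_mul (p : N) (b c : B) : matCorner p b * matCorner p c = matCorner p (b * c) :=
  Matrix.single_mul_single_same _ _ _ _ _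

theorem star_matCorner (p : N) (b : B) : star (matCorner p b) = matCorner p (star b) :=
  Matrix.conjTranspose_single _ _ _

theorem matCorner_injective (p : N) : Function.Injective (matCorner (B := B) p) :=
  fun b c h => by
    have := congrFun (congrFun h p) p
    simpa [matCorner, Matrix.single_apply_same] using this

theorem matTrace_matCorner (τ : B →ₗ[ℂ] ℂ) (p : N) (b : B) :
    matTrace N τ (matCorner p b) = τ b := by
  change ∑ q, τ (Matrix.single p p b q q) = τ b
  rw [Finset.sum_eq_single p]
  · rw [Matrix.single_apply_same]
  · intro q _ hq
    rw [Matrix.single_apply_of_ne _ _ _ _ _ (by tauto), map_zero]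
  · simp

theorem matCorner_one_mul_mul (p : N) (x : MatAlg N B) :
    matCorner p 1 * x * matCorner p 1 =
      matCorner p ((show CStarMatrix N N B from x) p p) := by
  refine (Matrix.single_mul_mul_single p p p p (1 : B) x 1).trans ?_
  rw [one_mul, mul_one]
  rfl

theorem sum_matCorner_one : ∑ p : N, matCorner p (1 : B) = 1 :=
  Matrix.sum_single_one

theorem isStarProjection_matCorner_iff (p : N) (b : B) :
    IsStarProjection (matCorner p b) ↔ IsStarProjection b := by
  rw [isStarProjection_iff, isStarProjection_iff, IsIdempotentElem, IsIdempotentElem,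
    IsSelfAdjoint, IsSelfAdjoint, matCorner_mul, star_matCorner, (matCorner_injective p).eq_iff,
    (matCorner_injective p).eq_iff]

/-- The canonical trace of a matrix algebra over a finite-dimensional C*-algebra. -/
theorem IsCanonicalTrace.matTrace [FiniteDimensional ℂ B] {τ : B →ₗ[ℂ] ℂ}
    (hτ : IsCanonicalTrace τ) : IsCanonicalTrace (matTrace N τ) := by
  refine ⟨matTrace_mul_comm hτ.1, fun e he => ?_⟩
  have hcomm := matTrace_mul_comm (N := N) hτ.1
  have hE : ∀ p : N, IsStarProjection (matCorner p (1 : B)) := fun p =>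
    (isStarProjection_matCorner_iff p 1).2 (IsStarProjection.one B)
  -- By minimality of `e`, each compression `e c_p e` of a diagonal unit is a scalar multiple of
  -- `e`. The units sum to `1`, so some scalar is nonzero.
  have hsc : ∀ p : N, ∃ r : ℝ, e * matCorner p (1 : B) * e = r • e := fun p =>
    he.exists_smul_eq (by
      rw [IsSelfAdjoint, star_mul, star_mul, he.1.2.star_eq, (hE p).2.star_eq, mul_assoc])
      (by rw [← mul_assoc, ← mul_assoc, he.1.1.eq])
  choose r hr using hsc
  have hex : ∃ p, r p ≠ 0 := by
    by_contra hcon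
    push Not at hcon
    apply he.2.1
    calc e = e * (∑ p : N, matCorner p (1 : B)) * e := by
          rw [sum_matCorner_one, mul_one, he.1.1.eq]
      _ = ∑ p : N, e * matCorner p (1 : B) * e := by rw [Finset.mul_sum, Finset.sum_mul]
      _ = 0 := Finset.sum_eq_zero fun p _ => by rw [hr, hcon, zero_smul]
  obtain ⟨p, hp⟩ := hex
  set c : MatAlg N B := matCorner p 1 with hc
  have hcc : c * c = c := (hE p).1
  have hee : e * e = e := he.1.1
  have hse : star e = e := he.1.2
  have hsc : star c = c := (hE p).2
  have hece : e * c * e = r p • e := hr p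
  -- From `e c e = r e` it follows that `f = r⁻¹ c e c` is a projection in the corner, with the same
  -- trace as `e`. It remains to see that its corner entry `b` is minimal in `B`, where the trace is
  -- known to be `1`.
  let f : MatAlg N B := (r p)⁻¹ • (c * e * c)
  obtain ⟨b, hb⟩ : ∃ b, f = matCorner p b := by
    refine ⟨(show CStarMatrix N N B from f) p p, ?_⟩
    rw [← matCorner_one_mul_mul]
    simp only [f, mul_smul_comm, smul_mul_assoc, ← hc]
    rw [← mul_assoc, ← mul_assoc, hcc, mul_assoc _ c c, hcc]
  have hcf : c * f = f := by simp only [f, mul_smul_comm, ← mul_assoc, hcc]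
  have hsf : star f = f := by
    simp only [f, star_smul, star_mul, hsc, hse, star_trivial, mul_assoc]
  have hff : f * f = f := by
    have : c * e * c * (c * e * c) = r p • (c * e * c) := by
      calc c * e * c * (c * e * c) = c * (e * (c * c) * e) * c := by simp only [mul_assoc]
        _ = r p • (c * e * c) := by rw [hcc, hece, mul_smul_comm, smul_mul_assoc]
    simp only [f, smul_mul_assoc, mul_smul_comm]
    rw [this, smul_smul (r p)⁻¹ (r p), inv_mul_cancel₀ hp, one_smul]
  have htf : CStarPressure.matTrace N τ f = CStarPressure.matTrace N τ e := by
    have h1 : CStarPressure.matTrace N τ (c * e * c) = CStarPressure.matTrace N τ (e * c * e) := by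
      calc CStarPressure.matTrace N τ (c * e * c)
          = CStarPressure.matTrace N τ ((c * e) * (e * c)) := by
            rw [← mul_assoc, mul_assoc c e e, hee]
        _ = CStarPressure.matTrace N τ (e * c * e) := by
            rw [hcomm, ← mul_assoc, mul_assoc e c c, hcc]
    rw [hece] at h1
    have hp' : (r p : ℂ) ≠ 0 := by exact_mod_cast hp
    refine (apply_real_smul (CStarPressure.matTrace N τ) (r p)⁻¹ (c * e * c)).trans ?_
    rw [h1.trans (apply_real_smul (CStarPressure.matTrace N τ) (r p) e), Complex.ofReal_inv,
      inv_mul_cancel_left₀ hp']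
  have hf0 : f ≠ 0 := by
    intro h0
    apply he.2.1
    have h1 : c * e * c = 0 := by
      have := congrArg (r p • ·) h0
      simpa [f, smul_smul, hp] using this
    have h2 : r p • r p • e = 0 := by
      calc r p • r p • e = (e * c * e) * (c * e) := by
            rw [hece, smul_mul_assoc, ← mul_assoc, hece]
        _ = e * (c * e * c) * e := by simp only [mul_assoc]
        _ = 0 := by rw [h1, mul_zero, zero_mul]
    simpa [hp] using h2
  have hmin : IsMinimalProjection b := by
    refine ⟨(isStarProjection_matCorner_iff p b).1 (hb ▸ ⟨hff, hsf⟩), ?_, fun g hg hbg => ?_⟩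
    · rintro rfl
      exact hf0 (hb.trans (Matrix.single_zero p p))
    have hG := (isStarProjection_matCorner_iff p g).2 hg
    set G : MatAlg N B := matCorner p g with hGdef
    have hfG : f * G = G := by rw [hb, hGdef, matCorner_mul, hbg]
    have hcG : c * G = G := by rw [hc, hGdef, matCorner_mul, one_mul]
    have hGG : G * G = G := hG.1
    have hsG : star G = G := hG.2
    have h1 : c * e * G = r p • G := by
      calc c * e * G = c * e * (c * G) := by rw [hcG]
        _ = r p • (f * G) := by
          simp only [f, smul_mul_assoc, smul_smul, mul_inv_cancel₀ hp, one_smul, mul_assoc]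
        _ = r p • G := by rw [hfG]
    have h2 : G * e * c = r p • G := by
      have := congrArg star h1
      simpa only [star_mul, star_smul, hsG, hse, hsc, star_trivial, mul_assoc] using this
    have hGc : G * c = G := by rw [hc, hGdef, matCorner_mul, mul_one]
    have h3 : G * e * G = r p • G := by
      calc G * e * G = G * c * e * G := by rw [hGc]
        _ = G * (c * e * G) := by simp only [mul_assoc]
        _ = r p • G := by rw [h1, mul_smul_comm, hGG]
    -- A projection `G` below `f` is carried back to a projection below `e`, which must be `0` or
    -- `e`. Compressing by `c` then gives `G = 0` or `G = f`.
    have hP : IsStarProjection ((r p)⁻¹ • (e * G * e)) := by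
      constructor
      · have : e * G * e * (e * G * e) = r p • (e * G * e) := by
          calc e * G * e * (e * G * e) = e * (G * (e * e) * G) * e := by simp only [mul_assoc]
            _ = r p • (e * G * e) := by rw [hee, h3, mul_smul_comm, smul_mul_assoc]
        rw [IsIdempotentElem, smul_mul_assoc, mul_smul_comm, this, smul_smul (r p)⁻¹ (r p),
          inv_mul_cancel₀ hp, one_smul]
      · rw [IsSelfAdjoint, star_smul, star_mul, star_mul, hse, hsG, star_trivial, mul_assoc]
    have hP' := he.2.2 _ hP (by rw [mul_smul_comm, ← mul_assoc, ← mul_assoc, hee])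
    have h4 : c * (e * G * e) * c = r p • r p • G := by
      calc c * (e * G * e) * c = (c * e * G) * (e * c) := by simp only [mul_assoc]
        _ = r p • r p • G := by rw [h1, smul_mul_assoc, ← mul_assoc, h2]
    have h5 : e * G * e = r p • ((r p)⁻¹ • (e * G * e)) := by
      rw [smul_smul, mul_inv_cancel₀ hp, one_smul]
    rcases hP' with h | h
    · left
      rw [h, smul_zero] at h5
      rw [h5, mul_zero, zero_mul] at h4
      have hG0 : G = 0 := by simpa [hp] using h4.symm
      exact matCorner_injective p (hG0.trans (Matrix.single_zero p p).symm)
    · right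
      rw [h] at h5
      rw [h5, mul_smul_comm, smul_mul_assoc] at h4
      have h6 : c * e * c = r p • f := by simp only [f, smul_smul, mul_inv_cancel₀ hp, one_smul]
      rw [h6] at h4
      have hGf : G = f := by
        have := smul_right_injective _ hp (smul_right_injective _ hp h4)
        exact this.symm
      exact matCorner_injective p (hGf.trans hb)
  rw [← htf, hb, matTrace_matCorner, hτ.2 b hmin]

end MatTrace

/-! ### Extending representations to ucp maps on all bounded operators -/

section Extension

open scoped ComplexOrder

section FunctionalExtension

variable {D : Type*} [CStarAlgebra D] [PartialOrder D] [StarOrderedRing D]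

/-- A functional on a unital C*-algebra attaining its norm at the unit is positive. -/
theorem functional_nonneg_of_norm_le (F : D →ₗ[ℂ] ℂ) {c : ℝ} (hF : ∀ x, ‖F x‖ ≤ c * ‖x‖)
    (h1 : F 1 = c) {x : D} (hx : 0 ≤ x) : 0 ≤ F x := by
  rcases subsingleton_or_nontrivial D with hD | hD
  · rw [Subsingleton.elim x 0, map_zero]
  have hc : 0 ≤ c := by
    have := (norm_nonneg _).trans (hF 1)
    rwa [norm_one, mul_one] at this
  have hsa := hx.isSelfAdjoint
  have hreal : ∀ t : ℝ, F (algebraMap ℝ D t) = t * c := by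
    intro t
    rw [Algebra.algebraMap_eq_smul_one, apply_real_smul, h1]
  have him : (F x).im = 0 := by
    -- Compare `|F(x + it)|²` with `c²‖x + it‖² ≤ c²(‖x‖² + t²)`. The terms `c²t²` cancel, leaving a
    -- term linear in `t` that must stay bounded, which forces the imaginary part to vanish.
    have key : ∀ t : ℝ, (F x).im ^ 2 + 2 * t * c * (F x).im ≤ c ^ 2 * ‖x‖ ^ 2 := by
      intro t
      have hy : F (x + Complex.I • algebraMap ℝ D t) = F x + Complex.I * (t * c) := by
        rw [map_add, map_smul, hreal, smul_eq_mul]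
      have hn : ‖x + Complex.I • algebraMap ℝ D t‖ ^ 2 ≤ ‖x‖ ^ 2 + t ^ 2 := by
        have hst : star (x + Complex.I • algebraMap ℝ D t) * (x + Complex.I • algebraMap ℝ D t) =
            x * x + algebraMap ℝ D (t ^ 2) := by
          have : star (algebraMap ℝ D t) = algebraMap ℝ D t :=
            IsSelfAdjoint.algebraMap D (.all t)
          rw [star_add, star_smul, hsa.star_eq, this, Complex.star_def, Complex.conj_I, add_mul,
            mul_add, mul_add, smul_mul_smul_comm, mul_smul_comm, smul_mul_assoc,
            ← Algebra.commutes t x, neg_mul, Complex.I_mul_I, neg_neg, one_smul, ← map_mul, pow_two,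
            neg_smul]
          abel
        rw [pow_two, ← CStarRing.norm_star_mul_self, hst, pow_two]
        refine (norm_add_le _ _).trans (add_le_add ((norm_mul_le _ _).trans_eq (pow_two _).symm) ?_)
        rw [norm_algebraMap', Real.norm_of_nonneg (mul_self_nonneg t)]
      have h2 := hF (x + Complex.I • algebraMap ℝ D t)
      have h3 : ‖F x + Complex.I * (t * c)‖ ^ 2 ≤ c ^ 2 * (‖x‖ ^ 2 + t ^ 2) := by
        rw [← hy]
        calc _ ≤ (c * ‖x + Complex.I • algebraMap ℝ D t‖) ^ 2 := by gcongr
          _ = c ^ 2 * ‖x + Complex.I • algebraMap ℝ D t‖ ^ 2 := by ring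
          _ ≤ _ := by gcongr
      rw [Complex.sq_norm, Complex.normSq_apply] at h3
      simp only [Complex.add_re, Complex.add_im, Complex.mul_re, Complex.mul_im, Complex.I_re,
        Complex.I_im, Complex.ofReal_re, Complex.ofReal_im] at h3
      nlinarith [sq_nonneg (F x).re]
    by_contra hne
    rcases hc.eq_or_lt with h0 | h0
    · have := key 0
      rw [← h0] at this
      have : 0 < (F x).im ^ 2 := by positivity
      nlinarith
    -- This `t` makes the linear term equal to `c²‖x‖² + 1`, exceeding the bound.
    · have := key ((c ^ 2 * ‖x‖ ^ 2 + 1) / (2 * c * (F x).im))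
      have e : 2 * ((c ^ 2 * ‖x‖ ^ 2 + 1) / (2 * c * (F x).im)) * c * (F x).im =
          c ^ 2 * ‖x‖ ^ 2 + 1 := by field_simp
      rw [e] at this
      nlinarith [sq_nonneg (F x).im]
  have hre : 0 ≤ (F x).re := by
    have hn : ‖algebraMap ℝ D ‖x‖ - x‖ ≤ ‖x‖ := by
      have h0 : 0 ≤ algebraMap ℝ D ‖x‖ - x := sub_nonneg.2 hsa.le_algebraMap_norm_self
      rw [CStarAlgebra.norm_le_iff_le_algebraMap _ (norm_nonneg x) h0]
      exact sub_le_self _ hx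
    have h2 := (hF _).trans (mul_le_mul_of_nonneg_left hn hc)
    rw [map_sub, hreal] at h2
    have h3 := (Complex.re_le_norm _).trans h2
    rw [Complex.sub_re, ← Complex.ofReal_mul, Complex.ofReal_re] at h3
    linarith
  exact Complex.nonneg_iff.2 ⟨hre, him.symm⟩

/-- A vector state of a C*-subalgebra extends to a positive functional. -/
theorem exists_positive_extension {A : Type*} [CStarAlgebra A] (π : A →⋆ₐ[ℂ] D)
    (hπ : Function.Injective π) {K : Type*} [NormedAddCommGroup K] [InnerProductSpace ℂ K]
    [CompleteSpace K] (σ : A →⋆ₐ[ℂ] (K →L[ℂ] K)) (ξ : K) :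
    ∃ g : D →ₚ[ℂ] ℂ, ∀ a, g (π a) = ⟪ξ, σ a ξ⟫_ℂ := by
  let e := LinearEquiv.ofInjective (π : A →ₗ[ℂ] D) hπ
  let f₀ : LinearMap.range (π : A →ₗ[ℂ] D) →ₗ[ℂ] ℂ :=
    (((innerSL ℂ ξ : K →L[ℂ] ℂ) : K →ₗ[ℂ] ℂ) ∘ₗ
      ((ContinuousLinearMap.apply ℂ K ξ : (K →L[ℂ] K) →L[ℂ] K) : (K →L[ℂ] K) →ₗ[ℂ] K) ∘ₗ
      (σ : A →ₗ[ℂ] (K →L[ℂ] K))) ∘ₗ (e.symm : _ →ₗ[ℂ] A)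
  have hf₀ : ∀ y, ‖f₀ y‖ ≤ ‖ξ‖ ^ 2 * ‖y‖ := by
    intro y
    obtain ⟨a, rfl⟩ := e.surjective y
    have h1 : f₀ (e a) = ⟪ξ, σ a ξ⟫_ℂ := by simp [f₀]
    have h2 : ‖e a‖ = ‖a‖ := NonUnitalStarAlgHom.norm_map π hπ a
    rw [h1, h2]
    calc ‖⟪ξ, σ a ξ⟫_ℂ‖ ≤ ‖ξ‖ * ‖σ a ξ‖ := norm_inner_le_norm _ _
      _ ≤ ‖ξ‖ * (‖a‖ * ‖ξ‖) := by
        gcongr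
        exact (ContinuousLinearMap.le_opNorm _ _).trans
          (mul_le_mul_of_nonneg_right (NonUnitalStarAlgHom.norm_apply_le σ a) (norm_nonneg _))
      _ = ‖ξ‖ ^ 2 * ‖a‖ := by ring
  -- Hahn–Banach keeps the norm at most `‖ξ‖²`, which is also the value at the unit; hence the
  -- extension is positive.
  obtain ⟨F, hF, hFn⟩ := exists_extension_norm_eq _ (f₀.mkContinuous _ hf₀)
  have hFπ : ∀ a, F (π a) = ⟪ξ, σ a ξ⟫_ℂ := by
    intro a
    have := hF (e a)
    refine this.trans ?_
    simp [f₀]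
  have hFle : ∀ x, ‖F x‖ ≤ ‖ξ‖ ^ 2 * ‖x‖ := fun x =>
    (F.le_opNorm x).trans (mul_le_mul_of_nonneg_right
      (hFn.trans_le (LinearMap.mkContinuous_norm_le _ (by positivity) _)) (norm_nonneg _))
  refine ⟨PositiveLinearMap.mk₀ (F : D →ₗ[ℂ] ℂ) fun x hx =>
    functional_nonneg_of_norm_le (F : D →ₗ[ℂ] ℂ) hFle ?_ hx, hFπ⟩
  have := hFπ 1
  rw [map_one π, map_one σ, one_apply_eq_self, inner_self_eq_norm_sq_to_K] at this
  simpa using this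

end FunctionalExtension

section DirectSum

variable {D : Type*} [CStarAlgebra D] {ι : Type*} {L : ι → Type*}
  [∀ i, NormedAddCommGroup (L i)]

theorem summable_sq (ξ : lp L 2) : Summable fun i => ‖ξ i‖ ^ 2 := by
  have := (lp.memℓp ξ).summable (by norm_num)
  simpa only [ENNReal.toReal_ofNat, Real.rpow_two] using this

theorem norm_sq_eq_tsum (ξ : lp L 2) : ‖ξ‖ ^ 2 = ∑' i, ‖ξ i‖ ^ 2 := by
  have := lp.norm_rpow_eq_tsum (p := 2) (by norm_num) ξ
  simpa only [ENNReal.toReal_ofNat, Real.rpow_two] using this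

variable [∀ i, InnerProductSpace ℂ (L i)] [∀ i, CompleteSpace (L i)]

theorem norm_starAlgHom_apply_le (σ : ∀ i, D →⋆ₐ[ℂ] (L i →L[ℂ] L i)) (x : D) (i : ι) (η : L i) :
    ‖σ i x η‖ ^ 2 ≤ ‖x‖ ^ 2 * ‖η‖ ^ 2 := by
  rw [← mul_pow]
  gcongr
  exact (ContinuousLinearMap.le_opNorm _ _).trans
    (mul_le_mul_of_nonneg_right (NonUnitalStarAlgHom.norm_apply_le (σ i) x) (norm_nonneg _))

theorem summable_starAlgHom_apply (σ : ∀ i, D →⋆ₐ[ℂ] (L i →L[ℂ] L i)) (x : D) (ξ : lp L 2) :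
    Summable fun i => ‖σ i x (ξ i)‖ ^ 2 :=
  ((summable_sq ξ).mul_left (‖x‖ ^ 2)).of_nonneg_of_le (fun _ => by positivity)
    fun i => norm_starAlgHom_apply_le σ x i (ξ i)

theorem memℓp_starAlgHom_apply (σ : ∀ i, D →⋆ₐ[ℂ] (L i →L[ℂ] L i)) (x : D) (ξ : lp L 2) :
    Memℓp (fun i => σ i x (ξ i)) 2 := by
  refine memℓp_gen ?_
  simpa only [ENNReal.toReal_ofNat, Real.rpow_two] using summable_starAlgHom_apply σ x ξ

/-- The diagonal operator of a direct sum of representations. -/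
def directSumOp (σ : ∀ i, D →⋆ₐ[ℂ] (L i →L[ℂ] L i)) (x : D) : lp L 2 →L[ℂ] lp L 2 :=
  LinearMap.mkContinuous
    { toFun := fun ξ => ⟨fun i => σ i x (ξ i), memℓp_starAlgHom_apply σ x ξ⟩
      map_add' := fun ξ η => by ext i; exact map_add _ _ _
      map_smul' := fun c ξ => by ext i; exact map_smul _ _ _ }
    ‖x‖ fun ξ => by
      rw [← sq_le_sq₀ (norm_nonneg _) (by positivity), mul_pow, norm_sq_eq_tsum,
        norm_sq_eq_tsum, ← tsum_mul_left]
      exact (summable_starAlgHom_apply σ x ξ).tsum_le_tsum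
        (fun i => norm_starAlgHom_apply_le σ x i (ξ i)) ((summable_sq ξ).mul_left _)

theorem directSumOp_apply (σ : ∀ i, D →⋆ₐ[ℂ] (L i →L[ℂ] L i)) (x : D) (ξ : lp L 2) (i : ι) :
    directSumOp σ x ξ i = σ i x (ξ i) := rfl

/-- The direct sum of a family of representations. -/
def directSumRep (σ : ∀ i, D →⋆ₐ[ℂ] (L i →L[ℂ] L i)) : D →⋆ₐ[ℂ] (lp L 2 →L[ℂ] lp L 2) where
  toFun := directSumOp σ
  map_one' := by ext ξ n; simp [directSumOp_apply]
  map_mul' a b := by ext ξ n; simp [directSumOp_apply]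
  map_zero' := by ext ξ n; simp [directSumOp_apply]
  map_add' a b := by ext ξ n; simp [directSumOp_apply]
  commutes' c := by
    ext ξ n
    simp [directSumOp_apply, Algebra.algebraMap_eq_smul_one]
  map_star' a := by
    rw [ContinuousLinearMap.star_eq_adjoint, ContinuousLinearMap.eq_adjoint_iff]
    intro ξ η
    rw [lp.inner_eq_tsum, lp.inner_eq_tsum]
    refine tsum_congr fun n => ?_
    rw [directSumOp_apply, directSumOp_apply, map_star,
      ContinuousLinearMap.star_eq_adjoint, ContinuousLinearMap.adjoint_inner_left]

theorem directSumRep_single [DecidableEq ι] (σ : ∀ i, D →⋆ₐ[ℂ] (L i →L[ℂ] L i)) (x : D) (i : ι)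
    (η : L i) : directSumRep σ x (lp.single 2 i η) = lp.single 2 i (σ i x η) := by
  ext j
  change σ j x (lp.single 2 i η j) = _
  by_cases h : j = i
  · subst h; simp
  · simp [lp.single_apply, h]

end DirectSum

section Gram

variable {K L : Type*} [NormedAddCommGroup K] [InnerProductSpace ℂ K]
  [NormedAddCommGroup L] [InnerProductSpace ℂ L] [CompleteSpace L]

/-- Two families with the same Gram matrix are related by an isometry. -/
theorem exists_isometry_of_inner_eq {ι : Type*} (x : ι → K) (y : ι → L)
    (hxy : ∀ i j, ⟪x i, x j⟫_ℂ = ⟪y i, y j⟫_ℂ)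
    (hx : Dense (Submodule.span ℂ (Set.range x) : Set K)) :
    ∃ V : K →L[ℂ] L, (∀ i, V (x i) = y i) ∧ ∀ ξ, ‖V ξ‖ = ‖ξ‖ := by
  have hn : ∀ s : ι →₀ ℂ, ‖Finsupp.linearCombination ℂ y s‖ = ‖Finsupp.linearCombination ℂ x s‖ := by
    intro s
    rw [← sq_eq_sq₀ (norm_nonneg _) (norm_nonneg _), ← inner_self_eq_norm_sq (𝕜 := ℂ),
      ← inner_self_eq_norm_sq (𝕜 := ℂ)]
    congr 1
    simp only [Finsupp.linearCombination_apply, Finsupp.sum, sum_inner, inner_sum, inner_smul_left,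
      inner_smul_right, hxy]
  have hd : DenseRange (Finsupp.linearCombination ℂ x) := by
    rw [DenseRange, ← LinearMap.coe_range, Finsupp.range_linearCombination]
    exact hx
  let V := (Finsupp.linearCombination ℂ y).extendOfNorm (Finsupp.linearCombination ℂ x)
  have hV : ∀ s, V (Finsupp.linearCombination ℂ x s) = Finsupp.linearCombination ℂ y s :=
    LinearMap.extendOfNorm_eq hd ⟨1, fun s => by rw [one_mul, hn]⟩
  refine ⟨V, fun i => ?_, fun ξ => ?_⟩
  · simpa using hV (Finsupp.single i 1)
  · refine hd.induction_on (p := fun ξ => ‖V ξ‖ = ‖ξ‖) ξ ?_ fun s => ?_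
    · exact isClosed_eq (by fun_prop) (by fun_prop)
    · rw [hV, hn]

/-- Compression of a representation by an isometry is ucp. -/
theorem isUCP_isometry_compress [CompleteSpace K] {D : Type*} [CStarAlgebra D] (σ : D →⋆ₐ[ℂ] (L →L[ℂ] L))
    (V : K →L[ℂ] L) (hV : V.adjoint ∘L V = 1) (f : D →ₗ[ℂ] (K →L[ℂ] K))
    (hf : ∀ x, f x = V.adjoint ∘L σ x ∘L V) : IsUCP f := by
  refine isUCP_of_inner f ?_ fun k a ξ => ?_
  · rw [hf, map_one]
    exact hV
  · have : ∑ i, ∑ j, ⟪ξ i, f (star (a i) * a j) (ξ j)⟫_ℂ =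
        ⟪∑ i, σ (a i) (V (ξ i)), ∑ j, σ (a j) (V (ξ j))⟫_ℂ := by
      simp only [sum_inner, inner_sum]
      rw [Finset.sum_comm]
      refine Finset.sum_congr rfl fun i _ => Finset.sum_congr rfl fun j _ => ?_
      rw [hf, map_mul, map_star, ContinuousLinearMap.star_eq_adjoint,
        ContinuousLinearMap.comp_apply, ContinuousLinearMap.adjoint_inner_right,
        ContinuousLinearMap.comp_apply, mul_apply_eq_comp,
        ContinuousLinearMap.adjoint_inner_right]
    rw [this, inner_self_eq_norm_sq_to_K]
    have h := sq_nonneg ‖∑ i, σ (a i) (V (ξ i))‖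
    rw [← RCLike.ofReal_pow]
    exact Complex.zero_le_real.2 h

end Gram

section Extension

variable {A : Type*} [CStarAlgebra A] {H : Type*} [NormedAddCommGroup H] [InnerProductSpace ℂ H]
  [CompleteSpace H] {K : Type*} [NormedAddCommGroup K] [InnerProductSpace ℂ K] [CompleteSpace K]

/-- Every representation is a direct sum of cyclic ones. -/
theorem exists_cyclic_decomposition (σ : A →⋆ₐ[ℂ] (K →L[ℂ] K)) :
    ∃ S : Set K, (∀ ξ ∈ S, ∀ η ∈ S, ξ ≠ η → ∀ a, ⟪ξ, σ a η⟫_ℂ = 0) ∧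
      Dense (Submodule.span ℂ (Set.range fun p : S × A => σ p.2 (p.1 : K)) : Set K) := by
  obtain ⟨S, hS⟩ := zorn_subset
    {S : Set K | ∀ ξ ∈ S, ∀ η ∈ S, ξ ≠ η → ∀ a, ⟪ξ, σ a η⟫_ℂ = 0} (by
      intro c hc hchain
      refine ⟨⋃₀ c, ?_, fun s hs => Set.subset_sUnion_of_mem hs⟩
      rintro ξ ⟨s, hs, hξ⟩ η ⟨t, ht, hη⟩ hne
      rcases hchain.total hs ht with h | h
      · exact hc ht ξ (h hξ) η hη hne
      · exact hc hs ξ hξ η (h hη) hne)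
  refine ⟨S, hS.prop, ?_⟩
  rw [Submodule.dense_iff_topologicalClosure_eq_top, Submodule.topologicalClosure_eq_top_iff,
    Submodule.eq_bot_iff]
  intro ζ hζ
  rw [Submodule.mem_orthogonal'] at hζ
  have h0 : ∀ ξ ∈ S, ∀ a, ⟪ζ, σ a ξ⟫_ℂ = 0 := fun ξ hξ a =>
    hζ _ (Submodule.subset_span ⟨(⟨ξ, hξ⟩, a), rfl⟩)
  have h0' : ∀ ξ ∈ S, ∀ a, ⟪ξ, σ a ζ⟫_ℂ = 0 := by
    intro ξ hξ a
    rw [← inner_conj_symm, ← ContinuousLinearMap.adjoint_inner_right,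
      ← ContinuousLinearMap.star_eq_adjoint, ← map_star, h0 ξ hξ, map_zero]
  -- A vector orthogonal to all the cyclic subspaces can be adjoined to the maximal family, so it
  -- already belongs to it; then it is orthogonal to itself.
  have hmem : ζ ∈ S := by
    refine hS.le_of_ge (y := insert ζ S) ?_ (Set.subset_insert _ _) (Set.mem_insert _ _)
    rintro ξ (rfl | hξ) η (rfl | hη) hne a
    · exact absurd rfl hne
    · exact h0 η hη a
    · exact h0' ξ hξ a
    · exact hS.prop ξ hξ η hη hne a
  have := h0 ζ hmem 1
  rwa [map_one, one_apply_eq_self, inner_self_eq_zero] at this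

/-- Two faithful representations are related by a ucp map of the full operator algebras. -/
theorem exists_ucp_extension (π : A →⋆ₐ[ℂ] (H →L[ℂ] H)) (hπ : Function.Injective π)
    (σ : A →⋆ₐ[ℂ] (K →L[ℂ] K)) :
    ∃ Φ : (H →L[ℂ] H) →ₗ[ℂ] (K →L[ℂ] K), IsUCP Φ ∧ ∀ a, Φ (π a) = σ a := by
  classical
  obtain ⟨S, hS, hdense⟩ := exists_cyclic_decomposition σ
  choose g hg using fun ξ : S => exists_positive_extension π hπ σ (ξ : K)
  let τ := directSumRep fun ξ : S => (g ξ).gnsStarAlgHom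
  let y : S × A → lp (fun ξ : S => (g ξ).GNS) 2 := fun p =>
    lp.single 2 p.1 (((g p.1).toPreGNS (π p.2) : (g p.1).PreGNS) : (g p.1).GNS)
  have hy : ∀ (x : A) (p : S × A), τ (π x) (y p) = y (p.1, x * p.2) := by
    intro x p
    refine (directSumRep_single _ _ _ _).trans ?_
    congr 1
    refine (PositiveLinearMap.gnsNonUnitalStarAlgHom_apply_coe _).trans ?_
    rw [map_mul]
    rfl
  -- The Gram matrices agree: on one cyclic piece because `g ξ` extends the vector state, across
  -- pieces because both sides are orthogonal.
  obtain ⟨V, hV, hVn⟩ := exists_isometry_of_inner_eq (fun p : S × A => σ p.2 (p.1 : K)) y (by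
    rintro ⟨ξ, a⟩ ⟨η, b⟩
    rw [lp.inner_single_left]
    by_cases h : ξ = η
    · subst h
      simp only [y, lp.single_apply_self]
      rw [UniformSpace.Completion.inner_coe, PositiveLinearMap.preGNS_inner_def,
        PositiveLinearMap.ofPreGNS_toPreGNS, PositiveLinearMap.ofPreGNS_toPreGNS, ← map_star,
        ← map_mul, hg, map_mul, map_star, ContinuousLinearMap.star_eq_adjoint, mul_apply_eq_comp,
        ContinuousLinearMap.adjoint_inner_right]
    · have h1 : (y (η, b)) ξ = 0 := by
        simp [y, lp.single_apply, h]
      rw [h1, inner_zero_right, ← ContinuousLinearMap.adjoint_inner_right,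
        ← ContinuousLinearMap.star_eq_adjoint, ← map_star, ← mul_apply_eq_comp, ← map_mul]
      exact hS ξ ξ.2 η η.2 (fun h' => h (Subtype.ext h')) _) hdense
  have hVV : V.adjoint ∘L V = 1 := V.norm_map_iff_adjoint_comp_self.1 hVn
  let Φ : (H →L[ℂ] H) →ₗ[ℂ] (K →L[ℂ] K) :=
    { toFun := fun x => V.adjoint ∘L τ x ∘L V
      map_add' := fun x y => by ext; simp
      map_smul' := fun c x => by ext; simp }
  refine ⟨Φ, isUCP_isometry_compress τ V hVV Φ fun _ => rfl, fun a => ?_⟩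
  -- `V` intertwines `σ` with `τ ∘ π`, so compression by `V` returns `σ a` exactly.
  have hint : τ (π a) ∘L V = V ∘L σ a := by
    refine ContinuousLinearMap.ext_on hdense ?_
    rintro _ ⟨p, rfl⟩
    simp only [ContinuousLinearMap.comp_apply]
    rw [hV, hy, ← hV, map_mul]
    rfl
  change V.adjoint ∘L τ (π a) ∘L V = σ a
  rw [hint, ← ContinuousLinearMap.comp_assoc, hVV]
  rfl

end Extension

end Extension

/-! ### The monomials `x u^k` and their density in the crossed product -/

section CrossedProductMonomials

variable {A : Type u} [CStarAlgebra A] {H : Type v} [NormedAddCommGroup H]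
  [InnerProductSpace ℂ H] [CompleteSpace H]

theorem translation_zpow_apply (k : ℤ) (ξ : L2Z H) (n : ℤ) :
    ((translation H ^ k : unitary (L2Z H →L[ℂ] L2Z H)) : L2Z H →L[ℂ] L2Z H) ξ n = ξ (n - k) := by
  have hinv : ∀ (ξ : L2Z H) (n : ℤ),
      (((translation H)⁻¹ : unitary (L2Z H →L[ℂ] L2Z H)) : L2Z H →L[ℂ] L2Z H) ξ n = ξ (n + 1) := by
    intro ξ n
    have h : (translation H : L2Z H →L[ℂ] L2Z H)
        ((((translation H)⁻¹ : unitary (L2Z H →L[ℂ] L2Z H)) : L2Z H →L[ℂ] L2Z H) ξ) = ξ := by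
      rw [← mul_apply_eq_comp, ← Submonoid.coe_mul, mul_inv_cancel]
      rfl
    conv_rhs => rw [← h, translation_apply, add_sub_cancel_right]
  induction k using Int.induction_on generalizing n ξ with
  | zero => simp
  | succ i ih =>
    rw [zpow_add_one, Submonoid.coe_mul, mul_apply_eq_comp, ih, translation_apply]
    exact congrArg (fun t => ξ t) (by ring)
  | pred i ih =>
    rw [zpow_sub_one, Submonoid.coe_mul, mul_apply_eq_comp, ih, hinv]
    exact congrArg (fun t => ξ t) (by ring)

/-- The image of a unitary under a *-homomorphism. -/
def mapUnitary {C : Type*} {D : Type*} [CStarAlgebra C] [CStarAlgebra D] (f : C →⋆ₐ[ℂ] D) (v : unitary C) :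
    unitary D :=
  ⟨f v, Unitary.map_mem f v.2⟩

theorem map_unitary_zpow {C : Type*} {D : Type*} [CStarAlgebra C] [CStarAlgebra D]
    (f : C →⋆ₐ[ℂ] D) (v : unitary C) (k : ℤ) :
    f ((v ^ k : unitary C) : C) = ((mapUnitary f v ^ k : unitary D) : D) := by
  let F : unitary C →* unitary D :=
    { toFun := mapUnitary f
      map_one' := Subtype.ext (map_one f)
      map_mul' := fun a b => Subtype.ext (map_mul f _ _) }
  exact congrArg Subtype.val (map_zpow F v k)

variable (π : A →⋆ₐ[ℂ] (H →L[ℂ] H)) (θ : A ≃⋆ₐ[ℂ] A)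

/-- The element `x u^k` of the crossed product. -/
def monomial (x : A) (k : ℤ) : crossedProduct π θ :=
  inclusion π θ x * ((canonicalUnitary π θ ^ k : unitary (crossedProduct π θ)) : crossedProduct π θ)

theorem coe_monomial (x : A) (k : ℤ) :
    (monomial π θ x k : L2Z H →L[ℂ] L2Z H) = regularRep π θ x *
      ((translation H ^ k : unitary (L2Z H →L[ℂ] L2Z H)) : L2Z H →L[ℂ] L2Z H) :=
  congrArg (regularRep π θ x * ·)
    (map_unitary_zpow (crossedProduct π θ).subtype (canonicalUnitary π θ) k)

theorem coe_monomial_apply (x : A) (k : ℤ) (ξ : L2Z H) (n : ℤ) :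
    (monomial π θ x k : L2Z H →L[ℂ] L2Z H) ξ n = π ((θ ^ (-n)) x) (ξ (n - k)) := by
  rw [coe_monomial, mul_apply_eq_comp]
  change π ((θ ^ (-n)) x) _ = _
  rw [translation_zpow_apply]

theorem coe_monomial_mul_monomial (x y : A) (k l : ℤ) :
    (monomial π θ x k : L2Z H →L[ℂ] L2Z H) * (monomial π θ y l : L2Z H →L[ℂ] L2Z H) =
      monomial π θ (x * (θ ^ k) y) (k + l) := by
  ext ξ n
  rw [mul_apply_eq_comp, coe_monomial_apply, coe_monomial_apply, coe_monomial_apply, map_mul, map_mul,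
    mul_apply_eq_comp, ← StarAlgEquiv.mul_apply, ← zpow_add, sub_sub, neg_sub, sub_eq_neg_add]

theorem adUnitary_monomial (x : A) (k : ℤ) :
    adUnitary π θ (monomial π θ x k) = monomial π θ (θ x) k := by
  rw [monomial, map_mul, adUnitary_inclusion, monomial]
  congr 1
  rw [adUnitary, Unitary.conjStarAlgAut_apply]
  have h : canonicalUnitary π θ * canonicalUnitary π θ ^ k * (canonicalUnitary π θ)⁻¹ =
      canonicalUnitary π θ ^ k := by
    rw [← zpow_one_add, ← zpow_sub_one]
    congr 1; ring
  exact congrArg Subtype.val h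

theorem iterate_adUnitary_monomial (j : ℕ) (x : A) (k : ℤ) :
    (adUnitary π θ)^[j] (monomial π θ x k) = monomial π θ (θ^[j] x) k := by
  induction j with
  | zero => rfl
  | succ j ih => rw [Function.iterate_succ_apply', ih, adUnitary_monomial,
      Function.iterate_succ_apply']

theorem iterate_adUnitary_inclusion (j : ℕ) (x : A) :
    (adUnitary π θ)^[j] (inclusion π θ x) = inclusion π θ (θ^[j] x) := by
  induction j with
  | zero => rfl
  | succ j ih => rw [Function.iterate_succ_apply', ih, adUnitary_inclusion,
      Function.iterate_succ_apply']

theorem monomial_zero (x : A) : monomial π θ x 0 = inclusion π θ x := by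
  rw [monomial, zpow_zero]
  exact mul_one _

/-- The monomials `x u^k` span a dense subspace of the crossed product. -/
theorem mem_closure_span_monomial (z : crossedProduct π θ) :
    z ∈ closure (Submodule.span ℂ (Set.range fun p : A × ℤ => monomial π θ p.1 p.2) :
      Set (crossedProduct π θ)) := by
  let G : Set (L2Z H →L[ℂ] L2Z H) :=
    Set.range fun p : A × ℤ => (monomial π θ p.1 p.2 : L2Z H →L[ℂ] L2Z H)
  have hadj : ∀ T ∈ StarAlgebra.adjoin ℂ (Set.range (regularRep π θ) ∪
      {(translation H : L2Z H →L[ℂ] L2Z H)}), T ∈ Submodule.span ℂ G := by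
    -- By covariance the monomials are closed under multiplication. They contain the generators and
    -- their adjoints, so the generated *-algebra is contained in their linear span.
    let M : Submonoid (L2Z H →L[ℂ] L2Z H) :=
      { carrier := G
        one_mem' := ⟨(1, 0), by simp only [monomial_zero, map_one]; rfl⟩
        mul_mem' := by
          rintro _ _ ⟨p, rfl⟩ ⟨q, rfl⟩
          exact ⟨(p.1 * (θ ^ p.2) q.1, p.2 + q.2),
            (coe_monomial_mul_monomial π θ p.1 q.1 p.2 q.2).symm⟩ }
    have hle : Submonoid.closure ((Set.range (regularRep π θ) ∪
        {(translation H : L2Z H →L[ℂ] L2Z H)}) ∪ star (Set.range (regularRep π θ) ∪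
        {(translation H : L2Z H →L[ℂ] L2Z H)})) ≤ M := by
      have h1 : ∀ x, regularRep π θ x ∈ G := fun x =>
        ⟨(x, 0), congrArg Subtype.val (monomial_zero π θ x)⟩
      have h2 : ∀ k : ℤ, ((translation H ^ k : unitary (L2Z H →L[ℂ] L2Z H)) :
          L2Z H →L[ℂ] L2Z H) ∈ G := fun k => ⟨(1, k), by
        dsimp only
        rw [coe_monomial, map_one, one_mul]⟩
      rw [Submonoid.closure_le]
      rintro T ((⟨x, rfl⟩ | hT) | hT)
      · exact h1 x
      · rw [Set.mem_singleton_iff.1 hT]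
        have := h2 1
        rwa [zpow_one] at this
      · rw [Set.mem_star] at hT
        rcases hT with ⟨x, hx⟩ | hT
        · rw [← star_star T, ← hx, ← map_star]
          exact h1 _
        · rw [← star_star T, Set.mem_singleton_iff.1 hT]
          have := h2 (-1)
          rwa [zpow_neg_one] at this
    intro T hT
    rw [← StarSubalgebra.mem_toSubalgebra, StarAlgebra.adjoin_toSubalgebra,
      ← Subalgebra.mem_toSubmodule, Algebra.adjoin_eq_span] at hT
    exact Submodule.span_mono hle hT
  rw [closure_subtype]
  have hz := z.2
  refine closure_mono ?_ hz
  intro T hT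
  have := hadj T hT
  have himg : G = (crossedProduct π θ).subtype '' (Set.range fun p : A × ℤ => monomial π θ p.1 p.2) := by
    rw [← Set.range_comp]; rfl
  rw [himg] at this
  let ι : crossedProduct π θ →ₗ[ℂ] (L2Z H →L[ℂ] L2Z H) := (crossedProduct π θ).subtype
  have h4 : T ∈ Submodule.map ι
      (Submodule.span ℂ (Set.range fun p : A × ℤ => monomial π θ p.1 p.2)) := by
    rw [Submodule.map_span]
    exact this
  obtain ⟨y, hy, rfl⟩ := h4
  exact ⟨y, hy, rfl⟩

end CrossedProductMonomials

/-! ### Compression to a finite block and averaging back -/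

section Compression

variable {A : Type u} [CStarAlgebra A] {H : Type v} [NormedAddCommGroup H]
  [InnerProductSpace ℂ H]

/-- The inclusion of the `p`-th summand of `ℓ²(ℤ, H)`. -/
def summandIncl (H : Type v) [NormedAddCommGroup H] [InnerProductSpace ℂ H] (p : ℤ) :
    H →L[ℂ] L2Z H :=
  lp.singleContinuousLinearMap ℂ (fun _ : ℤ => H) 2 p

theorem inner_summandIncl_left (p : ℤ) (ξ : H) (η : L2Z H) :
    ⟪summandIncl H p ξ, η⟫_ℂ = ⟪ξ, η p⟫_ℂ :=
  lp.inner_single_left p ξ η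

theorem summandIncl_apply (p q : ℤ) (ξ : H) : summandIncl H p ξ q = if q = p then ξ else 0 := by
  change lp.single (E := fun _ : ℤ => H) 2 p ξ q = _
  rw [lp.single_apply, Pi.single_apply]

variable [CompleteSpace H]

/-- The matrix coefficient of an operator on `ℓ²(ℤ, H)`, as an operator on `H`. -/
def coeffOp (H : Type v) [NormedAddCommGroup H] [InnerProductSpace ℂ H] [CompleteSpace H]
    (p q : ℤ) : (L2Z H →L[ℂ] L2Z H) →ₗ[ℂ] (H →L[ℂ] H) where
  toFun T := (summandIncl H p).adjoint ∘L T ∘L summandIncl H q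
  map_add' S T := by ext; simp
  map_smul' c T := by ext; simp

theorem coeffOp_apply (p q : ℤ) (T : L2Z H →L[ℂ] L2Z H) (η : H) :
    coeffOp H p q T η = T (summandIncl H q η) p := by
  refine ext_inner_left ℂ fun ξ => ?_
  rw [← inner_summandIncl_left]
  exact ContinuousLinearMap.adjoint_inner_right (summandIncl H p) ξ (T (summandIncl H q η))

theorem continuous_coeffOp (p q : ℤ) : Continuous (coeffOp H p q) := by
  change Continuous fun T => (summandIncl H p).adjoint ∘L T ∘L summandIncl H q
  fun_prop

variable (π : A →⋆ₐ[ℂ] (H →L[ℂ] H)) (θ : A ≃⋆ₐ[ℂ] A)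

theorem coeffOp_monomial (x : A) (k p q : ℤ) :
    coeffOp H p q (monomial π θ x k) = π (if p - k = q then (θ ^ (-p)) x else 0) := by
  ext η
  rw [coeffOp_apply, coe_monomial_apply, summandIncl_apply]
  split_ifs <;> simp

/-- True for monomials by direct computation. A faithful `π` is isometric, so its range is closed
and density of the span of the monomials suffices. -/
theorem coeffOp_mem_range (hπ : Function.Injective π) (z : crossedProduct π θ) (p q : ℤ) :
    coeffOp H p q z ∈ LinearMap.range (π : A →ₗ[ℂ] (H →L[ℂ] H)) := by
  have hclosed : IsClosed {z : crossedProduct π θ |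
      coeffOp H p q z ∈ LinearMap.range (π : A →ₗ[ℂ] (H →L[ℂ] H))} := by
    have h1 : IsClosed (Set.range π) :=
      (NonUnitalStarAlgHom.isometry π hπ).isClosedEmbedding.isClosed_range
    exact h1.preimage ((continuous_coeffOp p q).comp continuous_subtype_val)
  refine closure_minimal ?_ hclosed (mem_closure_span_monomial π θ z)
  intro y hy
  have hle : Submodule.span ℂ (Set.range fun p : A × ℤ => monomial π θ p.1 p.2) ≤
      (LinearMap.range (π : A →ₗ[ℂ] (H →L[ℂ] H))).comap
        (coeffOp H p q ∘ₗ (crossedProduct π θ).subtype) := by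
    rw [Submodule.span_le]
    rintro _ ⟨r, rfl⟩
    exact ⟨_, (coeffOp_monomial π θ r.1 r.2 p q).symm⟩
  exact hle hy

variable {π}

/-- The matrix coefficient of an element of the crossed product, as an element of `A`. -/
def coeff (hπ : Function.Injective π) (p q : ℤ) : crossedProduct π θ →ₗ[ℂ] A :=
  ((LinearEquiv.ofInjective (π : A →ₗ[ℂ] (H →L[ℂ] H)) hπ).symm : _ →ₗ[ℂ] A) ∘ₗ
    LinearMap.codRestrict _ (coeffOp H p q ∘ₗ (crossedProduct π θ).subtype)
      fun z => coeffOp_mem_range π θ hπ z p q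

theorem map_coeff (hπ : Function.Injective π) (p q : ℤ) (z : crossedProduct π θ) :
    π (coeff θ hπ p q z) = coeffOp H p q z := by
  have := (LinearEquiv.ofInjective (π : A →ₗ[ℂ] (H →L[ℂ] H)) hπ).apply_symm_apply
    ⟨coeffOp H p q z, coeffOp_mem_range π θ hπ z p q⟩
  exact congrArg Subtype.val this

theorem coeff_monomial (hπ : Function.Injective π) (p q k : ℤ) (x : A) :
    coeff θ hπ p q (monomial π θ x k) = if p - k = q then (θ ^ (-p)) x else 0 :=
  hπ ((map_coeff θ hπ p q _).trans (coeffOp_monomial π θ x k p q))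

/-- The compression of the crossed product to the summands `0, …, m - 1` of `ℓ²(ℤ, H)`. -/
def blockCompress (hπ : Function.Injective π) (m : ℕ) :
    crossedProduct π θ →ₗ[ℂ] MatAlg (Fin m) A where
  toFun z := CStarMatrix.ofMatrix (Matrix.of fun i j : Fin m => coeff θ hπ i j z)
  map_add' y z := by ext i j; exact map_add (coeff θ hπ i j) y z
  map_smul' c z := by ext i j; exact map_smul (coeff θ hπ i j) c z

theorem isUCP_blockCompress (hπ : Function.Injective π) (m : ℕ) :
    IsUCP (blockCompress θ hπ m) := by
  refine isUCP_of_compress π hπ (crossedProduct π θ).subtype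
    (fun i : Fin m => summandIncl H (i : ℤ)) ?_ _ ?_
  · intro p q ξ η
    rw [inner_summandIncl_left, summandIncl_apply]
    simp only [Nat.cast_inj, Fin.val_inj]
    split_ifs <;> simp
  · intro z p q ξ η
    change ⟪ξ, π (coeff θ hπ p q z) η⟫_ℂ = _
    rw [map_coeff, coeffOp_apply, inner_summandIncl_left]
    rfl

theorem blockCompress_inclusion (hπ : Function.Injective π) (m : ℕ) (x : A) :
    blockCompress θ hπ m (inclusion π θ x) = matDiag fun i : Fin m => (θ ^ (-(i : ℤ))) x := by
  ext i j
  change coeff θ hπ i j (inclusion π θ x) = Matrix.diagonal _ i j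
  rw [← monomial_zero, coeff_monomial, Matrix.diagonal_apply]
  simp [Fin.val_inj]

variable {K : Type w} [NormedAddCommGroup K] [InnerProductSpace ℂ K] [CompleteSpace K]

/-- The coefficients of the averaging map. -/
def averageCoeff (W : unitary (K →L[ℂ] K)) (m : ℕ) (p : Fin m) : K →L[ℂ] K :=
  (((√m)⁻¹ : ℝ) : ℂ) • ((W ^ (-((p : ℕ) : ℤ)) : unitary (K →L[ℂ] K)) : K →L[ℂ] K)

/-- The map `[T p q] ↦ m⁻¹ ∑ W^p T_{pq} W^{-q}`. -/
def average (W : unitary (K →L[ℂ] K)) (m : ℕ) :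
    MatAlg (Fin m) (K →L[ℂ] K) →ₗ[ℂ] (K →L[ℂ] K) :=
  rowCompress (averageCoeff W m)

theorem star_averageCoeff_mul_mul (W : unitary (K →L[ℂ] K)) (m : ℕ) (p q : Fin m)
    (T : K →L[ℂ] K) : star (averageCoeff W m p) * T * averageCoeff W m q =
      ((m : ℂ)⁻¹) • (((W ^ ((p : ℕ) : ℤ) : unitary (K →L[ℂ] K)) : K →L[ℂ] K) * T *
        ((W ^ (-((q : ℕ) : ℤ)) : unitary (K →L[ℂ] K)) : K →L[ℂ] K)) := by
  have h1 : star ((W ^ (-((p : ℕ) : ℤ)) : unitary (K →L[ℂ] K)) : K →L[ℂ] K) =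
      ((W ^ ((p : ℕ) : ℤ) : unitary (K →L[ℂ] K)) : K →L[ℂ] K) := by
    rw [← Unitary.coe_star, Unitary.star_eq_inv, zpow_neg, inv_inv]
  have h2 : (((√m)⁻¹ : ℝ) : ℂ) * (((√m)⁻¹ : ℝ) : ℂ) = (m : ℂ)⁻¹ := by
    rw [← Complex.ofReal_mul, ← mul_inv, Real.mul_self_sqrt (Nat.cast_nonneg m)]
    simp
  rw [averageCoeff, averageCoeff, star_smul, h1, smul_mul_assoc, smul_mul_assoc, mul_smul_comm,
    smul_smul, Complex.star_def, Complex.conj_ofReal, h2]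

/-- The scaled unitaries `m^{-1/2} W^{-p}` form a column isometry, so this is a case of
`isUCP_rowCompress`. -/
theorem isUCP_average (W : unitary (K →L[ℂ] K)) {m : ℕ} (hm : 0 < m) :
    IsUCP (average W m) := by
  refine isUCP_rowCompress _ ?_
  have : ∀ p : Fin m, star (averageCoeff W m p) * averageCoeff W m p =
      ((m : ℂ)⁻¹) • (1 : K →L[ℂ] K) := by
    intro p
    have h := star_averageCoeff_mul_mul W m p p 1
    rw [mul_one, mul_one, ← Submonoid.coe_mul, ← zpow_add, add_neg_cancel, zpow_zero] at h
    exact h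
  simp_rw [this]
  rw [Finset.sum_const, Finset.card_univ, Fintype.card_fin, ← Nat.cast_smul_eq_nsmul ℂ, smul_smul,
    mul_inv_cancel₀ (by exact_mod_cast hm.ne'), one_smul]

/-- Compress the crossed product to a block, apply `f` entrywise and average back. -/
def blockMap (hπ : Function.Injective π) (W : unitary (K →L[ℂ] K)) (m : ℕ)
    (f : A →ₗ[ℂ] (K →L[ℂ] K)) : crossedProduct π θ →ₗ[ℂ] (K →L[ℂ] K) :=
  average W m ∘ₗ matMapLin (Fin m) f ∘ₗ blockCompress θ hπ m

theorem isUCP_blockMap (hπ : Function.Injective π) (W : unitary (K →L[ℂ] K)) {m : ℕ} (hm : 0 < m)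
    {f : A →ₗ[ℂ] (K →L[ℂ] K)} (hf : IsUCP f) : IsUCP (blockMap θ hπ W m f) :=
  (isUCP_average W hm).comp ((hf.matMapLin (Fin m)).comp (isUCP_blockCompress θ hπ m))

theorem blockMap_monomial (hπ : Function.Injective π) (W : unitary (K →L[ℂ] K)) (m : ℕ)
    (f : A →ₗ[ℂ] (K →L[ℂ] K)) (x : A) (k : ℤ) :
    blockMap θ hπ W m f (monomial π θ x k) = ∑ p : Fin m,
      if 0 ≤ (p : ℤ) - k ∧ (p : ℤ) - k < m then
        ((m : ℂ)⁻¹) • (((W ^ ((p : ℕ) : ℤ) : unitary (K →L[ℂ] K)) : K →L[ℂ] K) *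
          f ((θ ^ (-((p : ℕ) : ℤ))) x) *
          ((W ^ (k - ((p : ℕ) : ℤ)) : unitary (K →L[ℂ] K)) : K →L[ℂ] K)) else 0 := by
  have h0 : blockMap θ hπ W m f (monomial π θ x k) = ∑ p : Fin m, ∑ q : Fin m,
      star (averageCoeff W m p) * f (coeff θ hπ p q (monomial π θ x k)) *
        averageCoeff W m q := rfl
  rw [h0]
  refine Finset.sum_congr rfl fun p _ => ?_
  simp_rw [coeff_monomial]
  split_ifs with h
  -- In row `p` the matrix of `x u^k` has its only possible nonzero entry in column `p - k`, which
  -- may fall outside the block.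
  · obtain ⟨q, hq⟩ := Int.eq_ofNat_of_zero_le h.1
    have hqm : q < m := by omega
    rw [Finset.sum_eq_single ⟨q, hqm⟩]
    · rw [if_pos hq, star_averageCoeff_mul_mul]
      have : k - ((p : ℕ) : ℤ) = -(q : ℤ) := by omega
      rw [this]
    · intro q' _ hq'
      rw [if_neg, map_zero, mul_zero, zero_mul]
      intro h'
      apply hq'
      ext
      simp only
      omega
    · simp
  · refine Finset.sum_eq_zero fun q _ => ?_
    rw [if_neg, map_zero, mul_zero, zero_mul]
    intro h'
    apply h
    have := q.2
    omega

end Compression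

/-! ### Approximating elements of the crossed product uniformly along orbits -/

section Approximation

variable {A : Type u} [CStarAlgebra A] {H : Type v} [NormedAddCommGroup H]
  [InnerProductSpace ℂ H] [CompleteSpace H] {π : A →⋆ₐ[ℂ] (H →L[ℂ] H)} (θ : A ≃⋆ₐ[ℂ] A)
  {K : Type w} [NormedAddCommGroup K] [InnerProductSpace ℂ K] [CompleteSpace K]
  (ρ : crossedProduct π θ →⋆ₐ[ℂ] (K →L[ℂ] K))

/-- The unitary implementing the automorphism in a representation of the crossed product. -/
def repUnitary : unitary (K →L[ℂ] K) := mapUnitary ρ (canonicalUnitary π θ)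

theorem rep_monomial (x : A) (k : ℤ) : ρ (monomial π θ x k) = ρ (inclusion π θ x) *
    ((repUnitary θ ρ ^ k : unitary (K →L[ℂ] K)) : K →L[ℂ] K) := by
  rw [monomial, map_mul, map_unitary_zpow]
  rfl

/-- One factorization of the same element for every `p`, matching the `p`-th summand of
`blockMap_monomial` with `f` in place of the representation. -/
theorem rep_monomial_eq (x : A) (k p : ℤ) : ρ (monomial π θ x k) =
    ((repUnitary θ ρ ^ p : unitary (K →L[ℂ] K)) : K →L[ℂ] K) *
      ρ (inclusion π θ ((θ ^ (-p)) x)) *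
      ((repUnitary θ ρ ^ (k - p) : unitary (K →L[ℂ] K)) : K →L[ℂ] K) := by
  have h : monomial π θ x k = monomial π θ 1 p * monomial π θ ((θ ^ (-p)) x) (k - p) := by
    apply Subtype.ext
    refine Eq.trans ?_ (coe_monomial_mul_monomial π θ 1 _ p (k - p)).symm
    rw [one_mul, ← StarAlgEquiv.mul_apply, ← zpow_add, add_neg_cancel, zpow_zero,
      add_sub_cancel]
    rfl
  rw [h, map_mul, rep_monomial, rep_monomial, map_one, map_one, one_mul, mul_assoc]

theorem card_shift_out_le (m : ℕ) (k : ℤ) :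
    (Finset.univ.filter fun p : Fin m => ¬ (0 ≤ (p : ℤ) - k ∧ (p : ℤ) - k < m)).card ≤
      k.natAbs := by
  have h1 : (Finset.univ.filter fun p : Fin m => ¬ (0 ≤ (p : ℤ) - k ∧ (p : ℤ) - k < m)).card ≤
      (Finset.Ico (0 : ℤ) k ∪ Finset.Ico (m + k) (m : ℤ)).card := by
    refine Finset.card_le_card_of_injOn (fun p : Fin m => ((p : ℕ) : ℤ)) ?_ ?_
    · intro p hp
      simp only [Finset.coe_filter, Finset.mem_univ, true_and, Set.mem_ofPred_eq] at hp
      simp only [Finset.coe_union, Finset.coe_Ico, Set.mem_union, Set.mem_Ico]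
      have := p.2
      omega
    · intro p _ q _ h
      exact Fin.ext (by simpa using h)
  refine h1.trans ((Finset.card_union_le _ _).trans ?_)
  rw [Int.card_Ico, Int.card_Ico]
  omega

/-- Each of the `m` summands has weight `1/m`. Those with `p - k` in the block are off by at most
`δ`; the at most `|k|` others are lost entirely and account for the second term. -/
theorem norm_blockMap_monomial_sub_le (hπ : Function.Injective π) {m : ℕ} (hm : 0 < m)
    (f : A →ₗ[ℂ] (K →L[ℂ] K)) (x : A) (k : ℤ) {δ : ℝ} (hδ : 0 ≤ δ)
    (hf : ∀ p : Fin m, ‖f ((θ ^ (-((p : ℕ) : ℤ))) x) -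
      ρ (inclusion π θ ((θ ^ (-((p : ℕ) : ℤ))) x))‖ ≤ δ) :
    ‖blockMap θ hπ (repUnitary θ ρ) m f (monomial π θ x k) - ρ (monomial π θ x k)‖ ≤
      δ + (k.natAbs : ℝ) / m * ‖ρ (monomial π θ x k)‖ := by
  set W := repUnitary θ ρ with hW
  set c := ‖ρ (monomial π θ x k)‖ with hc
  have hm' : (0 : ℝ) < m := by exact_mod_cast hm
  have hmc : (m : ℂ) ≠ 0 := by exact_mod_cast hm.ne'
  have hsum : ρ (monomial π θ x k) = ∑ _p : Fin m, ((m : ℂ)⁻¹) • ρ (monomial π θ x k) := by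
    rw [Finset.sum_const, Finset.card_univ, Fintype.card_fin, ← Nat.cast_smul_eq_nsmul ℂ,
      smul_smul, mul_inv_cancel₀ hmc, one_smul]
  have hnm : ‖((m : ℂ)⁻¹)‖ = (m : ℝ)⁻¹ := by simp
  rw [blockMap_monomial]
  conv_lhs => rw [hsum]
  rw [← Finset.sum_sub_distrib]
  refine (norm_sum_le _ _).trans ?_
  have hterm : ∀ p : Fin m, ‖(if 0 ≤ (p : ℤ) - k ∧ (p : ℤ) - k < m then
        ((m : ℂ)⁻¹) • (((W ^ ((p : ℕ) : ℤ) : unitary (K →L[ℂ] K)) : K →L[ℂ] K) *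
          f ((θ ^ (-((p : ℕ) : ℤ))) x) *
          ((W ^ (k - ((p : ℕ) : ℤ)) : unitary (K →L[ℂ] K)) : K →L[ℂ] K)) else 0) -
        ((m : ℂ)⁻¹) • ρ (monomial π θ x k)‖ ≤
      (m : ℝ)⁻¹ * δ + if ¬ (0 ≤ (p : ℤ) - k ∧ (p : ℤ) - k < m) then (m : ℝ)⁻¹ * c else 0 := by
    intro p
    by_cases h : 0 ≤ (p : ℤ) - k ∧ (p : ℤ) - k < m
    · rw [if_pos h, if_neg (not_not.2 h), add_zero, rep_monomial_eq θ ρ x k (p : ℕ), ← smul_sub,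
        ← sub_mul, ← mul_sub, norm_smul, hnm, CStarRing.norm_mul_coe_unitary,
        CStarRing.norm_coe_unitary_mul]
      gcongr
      exact hf p
    · rw [if_neg h, if_pos h, zero_sub, norm_neg, norm_smul, hnm]
      have : 0 ≤ (m : ℝ)⁻¹ * δ := by positivity
      linarith
  refine (Finset.sum_le_sum fun p _ => hterm p).trans ?_
  rw [Finset.sum_add_distrib, Finset.sum_const, Finset.card_univ, Fintype.card_fin,
    ← Finset.sum_filter, Finset.sum_const, nsmul_eq_mul, nsmul_eq_mul]
  refine add_le_add ?_ ?_
  · rw [← mul_assoc, mul_inv_cancel₀ hm'.ne', one_mul]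
  · have := card_shift_out_le m k
    have h2 : ((Finset.univ.filter fun p : Fin m =>
        ¬ (0 ≤ (p : ℤ) - k ∧ (p : ℤ) - k < m)).card : ℝ) ≤ k.natAbs := by exact_mod_cast this
    have h3 : (0 : ℝ) ≤ (m : ℝ)⁻¹ * c := by positivity
    calc _ ≤ (k.natAbs : ℝ) * ((m : ℝ)⁻¹ * c) := mul_le_mul_of_nonneg_right h2 h3
      _ = _ := by ring

/-- An element of the crossed product all of whose translates are well approximated by
`blockMap`, for blocks that are large enough, as soon as `f` approximates the representation of
`A` on the translates of a suitable finite set. -/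
def Approximable (hπ : Function.Injective π) (z : crossedProduct π θ) : Prop :=
  ∀ ε > 0, ∃ m₀ : ℕ, ∀ m ≥ m₀, 0 < m → ∃ X : Finset A, ∃ δ > 0, ∀ (j : ℕ)
    (f : A →ₗ[ℂ] (K →L[ℂ] K)), IsUCP f →
    (∀ x ∈ X, ‖f (θ^[j] x) - ρ (inclusion π θ (θ^[j] x))‖ < δ) →
    ‖blockMap θ hπ (repUnitary θ ρ) m f ((adUnitary π θ)^[j] z) - ρ ((adUnitary π θ)^[j] z)‖ < ε

theorem iterate_eq_pow (j : ℕ) (x : A) : θ^[j] x = (θ ^ j) x := by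
  induction j with
  | zero => rfl
  | succ j ih => rw [Function.iterate_succ_apply', ih, pow_succ']; rfl

theorem iterate_zpow_comm (j : ℕ) (p : ℤ) (x : A) : θ^[j] ((θ ^ p) x) = (θ ^ p) (θ^[j] x) := by
  rw [iterate_eq_pow, iterate_eq_pow, ← StarAlgEquiv.mul_apply, ← StarAlgEquiv.mul_apply,
    ← zpow_natCast, ← zpow_add, ← zpow_add, add_comm]

theorem norm_iterate (j : ℕ) (x : A) : ‖θ^[j] x‖ = ‖x‖ := by
  induction j with
  | zero => rfl
  | succ j ih => rw [Function.iterate_succ_apply', NonUnitalStarAlgHom.norm_map θ θ.injective, ih]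

theorem approximable_monomial (hπ : Function.Injective π) (x : A) (k : ℤ) :
    Approximable θ ρ hπ (monomial π θ x k) := by
  classical
  intro ε hε
  obtain ⟨m₀, hm₀⟩ := exists_nat_gt ((k.natAbs : ℝ) * ‖x‖ / (ε / 2))
  -- The test set consists of the diagonal translates that occur in the block. It does not depend on
  -- `j`, because powers of `θ` commute.
  refine ⟨m₀, fun m hm hm0 => ⟨Finset.univ.image fun p : Fin m => (θ ^ (-((p : ℕ) : ℤ))) x,
    ε / 2, by positivity, fun j f _ hf => ?_⟩⟩
  rw [iterate_adUnitary_monomial]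
  have hm' : (0 : ℝ) < m := by exact_mod_cast hm0
  refine (norm_blockMap_monomial_sub_le θ ρ hπ hm0 f _ k (δ := ε / 2) (by positivity)
    fun p => ?_).trans_lt ?_
  · rw [← iterate_zpow_comm]
    exact (hf _ (Finset.mem_image_of_mem _ (Finset.mem_univ p))).le
  · have h1 : ‖ρ (monomial π θ (θ^[j] x) k)‖ ≤ ‖x‖ := by
      rw [rep_monomial, CStarRing.norm_mul_coe_unitary]
      refine (NonUnitalStarAlgHom.norm_apply_le ρ _).trans ?_
      refine (NonUnitalStarAlgHom.norm_apply_le (inclusion π θ) _).trans ?_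
      rw [norm_iterate]
    have h2 : (k.natAbs : ℝ) * ‖x‖ / (ε / 2) < m :=
      hm₀.trans_le (by exact_mod_cast hm)
    have h3 : (k.natAbs : ℝ) / m * ‖x‖ < ε / 2 := by
      rw [div_lt_iff₀ (by positivity)] at h2
      rw [div_mul_eq_mul_div, div_lt_iff₀ hm']
      linarith
    have h4 : (k.natAbs : ℝ) / m * ‖ρ (monomial π θ (θ^[j] x) k)‖ ≤ (k.natAbs : ℝ) / m * ‖x‖ := by
      gcongr
    linarith

theorem iterate_adUnitary_add (j : ℕ) (y z : crossedProduct π θ) :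
    (adUnitary π θ)^[j] (y + z) = (adUnitary π θ)^[j] y + (adUnitary π θ)^[j] z :=
  iterate_map_add (adUnitary π θ) j y z

theorem iterate_adUnitary_smul (j : ℕ) (c : ℂ) (z : crossedProduct π θ) :
    (adUnitary π θ)^[j] (c • z) = c • (adUnitary π θ)^[j] z := by
  induction j with
  | zero => rfl
  | succ j ih => rw [Function.iterate_succ_apply', ih, map_smul, Function.iterate_succ_apply']

theorem Approximable.add {hπ : Function.Injective π} {y z : crossedProduct π θ}
    (hy : Approximable θ ρ hπ y) (hz : Approximable θ ρ hπ z) :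
    Approximable θ ρ hπ (y + z) := by
  classical
  intro ε hε
  obtain ⟨m₁, h₁⟩ := hy (ε / 2) (by positivity)
  obtain ⟨m₂, h₂⟩ := hz (ε / 2) (by positivity)
  refine ⟨max m₁ m₂, fun m hm hm0 => ?_⟩
  obtain ⟨X, δ, hδ, h₁⟩ := h₁ m (le_of_max_le_left hm) hm0
  obtain ⟨Y, δ', hδ', h₂⟩ := h₂ m (le_of_max_le_right hm) hm0
  refine ⟨X ∪ Y, min δ δ', lt_min hδ hδ', fun j f hf hfX => ?_⟩
  have e₁ := h₁ j f hf fun x hx => (hfX x (Finset.mem_union_left _ hx)).trans_le (min_le_left _ _)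
  have e₂ := h₂ j f hf fun x hx => (hfX x (Finset.mem_union_right _ hx)).trans_le (min_le_right _ _)
  rw [iterate_adUnitary_add, map_add, map_add, add_sub_add_comm]
  refine (norm_add_le _ _).trans_lt ?_
  linarith

theorem Approximable.of_forall_norm_sub_lt {hπ : Function.Injective π} {z : crossedProduct π θ}
    (h : ∀ ε > 0, ∃ y, Approximable θ ρ hπ y ∧ ‖z - y‖ < ε) : Approximable θ ρ hπ z := by
  intro ε hε
  -- On `z - y` the block map costs at most `2 · ε/6` and the representation at most `ε/6`, leaving
  -- `ε/2` for `y`.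
  obtain ⟨y, hy, hzy⟩ := h (ε / 6) (by positivity)
  obtain ⟨m₀, h₀⟩ := hy (ε / 2) (by positivity)
  refine ⟨m₀, fun m hm hm0 => ?_⟩
  obtain ⟨X, δ, hδ, h₀⟩ := h₀ m hm hm0
  refine ⟨X, δ, hδ, fun j f hf hfX => ?_⟩
  have e₀ := h₀ j f hf hfX
  have hz : (adUnitary π θ)^[j] z = (adUnitary π θ)^[j] y + (adUnitary π θ)^[j] (z - y) := by
    rw [← iterate_adUnitary_add, add_sub_cancel]
  have hn : ‖(adUnitary π θ)^[j] (z - y)‖ = ‖z - y‖ := norm_iterate (adUnitary π θ) j (z - y)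
  have e₁ := (isUCP_blockMap θ hπ (repUnitary θ ρ) hm0 hf).norm_le ((adUnitary π θ)^[j] (z - y))
  have e₂ := NonUnitalStarAlgHom.norm_apply_le ρ ((adUnitary π θ)^[j] (z - y))
  rw [hn] at e₁ e₂
  rw [hz, map_add, map_add, add_sub_add_comm]
  refine (norm_add_le _ _).trans_lt ?_
  have e₃ := norm_sub_le (blockMap θ hπ (repUnitary θ ρ) m f ((adUnitary π θ)^[j] (z - y)))
    (ρ ((adUnitary π θ)^[j] (z - y)))
  linarith

theorem Approximable.smul {hπ : Function.Injective π} {z : crossedProduct π θ}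
    (hz : Approximable θ ρ hπ z) (c : ℂ) : Approximable θ ρ hπ (c • z) := by
  intro ε hε
  obtain ⟨m₀, h₀⟩ := hz (ε / (‖c‖ + 1)) (by positivity)
  refine ⟨m₀, fun m hm hm0 => ?_⟩
  obtain ⟨X, δ, hδ, h₀⟩ := h₀ m hm hm0
  refine ⟨X, δ, hδ, fun j f hf hfX => ?_⟩
  have e₀ := h₀ j f hf hfX
  rw [iterate_adUnitary_smul, map_smul, map_smul, ← smul_sub, norm_smul]
  rw [lt_div_iff₀ (by positivity)] at e₀
  nlinarith [norm_nonneg (blockMap θ hπ (repUnitary θ ρ) m f ((adUnitary π θ)^[j] z) -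
    ρ ((adUnitary π θ)^[j] z))]

theorem approximable (hπ : Function.Injective π) (z : crossedProduct π θ) :
    Approximable θ ρ hπ z := by
  refine Approximable.of_forall_norm_sub_lt θ ρ fun ε hε => ?_
  obtain ⟨y, hy, hzy⟩ := Metric.mem_closure_iff.1 (mem_closure_span_monomial π θ z) ε hε
  rw [dist_eq_norm] at hzy
  refine ⟨y, ?_, hzy⟩
  clear hzy
  induction hy using Submodule.span_induction with
  | mem y hy =>
    obtain ⟨p, rfl⟩ := hy
    exact approximable_monomial θ ρ hπ p.1 p.2
  | zero =>
    have := approximable_monomial θ ρ hπ 0 0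
    rwa [monomial_zero, map_zero] at this
  | add x y _ _ hx hy => exact hx.add θ ρ hy
  | smul c x _ hx => exact hx.smul θ ρ c

/-- Approximation on a finite subset of the crossed product. -/
theorem exists_approximation (hπ : Function.Injective π) (Ω : Finset (crossedProduct π θ))
    {ε : ℝ} (hε : 0 < ε) :
    ∃ m : ℕ, 0 < m ∧ ∃ X : Finset A, ∃ δ > 0, ∀ (j : ℕ) (f : A →ₗ[ℂ] (K →L[ℂ] K)), IsUCP f →
      (∀ x ∈ X, ‖f (θ^[j] x) - ρ (inclusion π θ (θ^[j] x))‖ < δ) → ∀ z ∈ Ω,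
      ‖blockMap θ hπ (repUnitary θ ρ) m f ((adUnitary π θ)^[j] z) -
        ρ ((adUnitary π θ)^[j] z)‖ < ε := by
  classical
  -- The block size must be common to all of `Ω`, so the induction carries the statement for all
  -- large `m`.
  suffices h : ∃ m₀ : ℕ, ∀ m ≥ m₀, 0 < m → ∃ X : Finset A, ∃ δ > 0, ∀ (j : ℕ)
      (f : A →ₗ[ℂ] (K →L[ℂ] K)), IsUCP f →
      (∀ x ∈ X, ‖f (θ^[j] x) - ρ (inclusion π θ (θ^[j] x))‖ < δ) → ∀ z ∈ Ω,
      ‖blockMap θ hπ (repUnitary θ ρ) m f ((adUnitary π θ)^[j] z) -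
        ρ ((adUnitary π θ)^[j] z)‖ < ε by
    obtain ⟨m₀, h⟩ := h
    exact ⟨m₀ + 1, Nat.succ_pos _, h (m₀ + 1) (Nat.le_succ _) (Nat.succ_pos _)⟩
  induction Ω using Finset.induction_on with
  | empty => exact ⟨0, fun m _ _ => ⟨∅, 1, one_pos, by simp⟩⟩
  | insert z Ω _ ih =>
    obtain ⟨m₁, h₁⟩ := ih
    obtain ⟨m₂, h₂⟩ := approximable θ ρ hπ z ε hε
    refine ⟨max m₁ m₂, fun m hm hm0 => ?_⟩
    obtain ⟨X, δ, hδ, h₁⟩ := h₁ m (le_of_max_le_left hm) hm0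
    obtain ⟨Y, δ', hδ', h₂⟩ := h₂ m (le_of_max_le_right hm) hm0
    refine ⟨X ∪ Y, min δ δ', lt_min hδ hδ', fun j f hf hfX y hy => ?_⟩
    rcases Finset.mem_insert.1 hy with rfl | hy
    · exact h₂ j f hf fun x hx =>
        (hfX x (Finset.mem_union_right _ hx)).trans_le (min_le_right _ _)
    · exact h₁ j f hf (fun x hx =>
        (hfX x (Finset.mem_union_left _ hx)).trans_le (min_le_left _ _)) y hy

end Approximation

/-! ### Almost invariance of orbit sums -/

section OrbitSum

variable {A : Type u} [CStarAlgebra A] (θ : A ≃⋆ₐ[ℂ] A)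

theorem isSelfAdjoint_iterate {a : A} (ha : IsSelfAdjoint a) (j : ℕ) :
    IsSelfAdjoint (θ^[j] a) := by
  induction j with
  | zero => exact ha
  | succ j ih =>
    rw [Function.iterate_succ_apply', IsSelfAdjoint, ← map_star, ih.star_eq]

theorem isSelfAdjoint_orbitSum {a : A} (ha : IsSelfAdjoint a) (n : ℕ) :
    IsSelfAdjoint (orbitSum θ a n) := by
  unfold orbitSum
  exact isSelfAdjoint_sum _ fun j _ => isSelfAdjoint_iterate θ ha j

theorem map_orbitSum_sub (a : A) (n : ℕ) :
    θ (orbitSum θ a n) - orbitSum θ a n = θ^[n] a - a := by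
  unfold orbitSum
  rw [map_sum]
  simp_rw [← Function.iterate_succ_apply' (⇑θ)]
  have h1 := Finset.sum_range_succ (fun j => θ^[j] a) n
  have h2 := Finset.sum_range_succ' (fun j => θ^[j] a) n
  rw [h1] at h2
  rw [← eq_sub_iff_add_eq] at h2
  rw [sub_eq_iff_eq_add', ← add_sub_assoc, h2]
  simp

/-- One application of `θ` changes the orbit sum only by the end terms `θ^n(a) - a`. The bound is
therefore linear in `i` and independent of `n`. -/
theorem norm_pow_orbitSum_sub_le (a : A) (n i : ℕ) :
    ‖(θ ^ (-(i : ℤ))) (orbitSum θ a n) - orbitSum θ a n‖ ≤ i * (2 * ‖a‖) := by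
  have hisom : ∀ (k : ℤ) (x : A), ‖(θ ^ k) x‖ = ‖x‖ := fun k x =>
    NonUnitalStarAlgHom.norm_map (θ ^ k) (θ ^ k).injective x
  have hone : ‖θ (orbitSum θ a n) - orbitSum θ a n‖ ≤ 2 * ‖a‖ := by
    rw [map_orbitSum_sub]
    refine (norm_sub_le _ _).trans ?_
    rw [norm_iterate, two_mul]
  induction i with
  | zero => simp
  | succ i ih =>
    have h1 : (θ ^ (-((i + 1 : ℕ) : ℤ))) (orbitSum θ a n) - orbitSum θ a n =
        -((θ ^ (-((i + 1 : ℕ) : ℤ))) (θ (orbitSum θ a n) - orbitSum θ a n)) +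
        ((θ ^ (-(i : ℤ))) (orbitSum θ a n) - orbitSum θ a n) := by
      have h2 : (θ ^ (-((i + 1 : ℕ) : ℤ))) (θ (orbitSum θ a n)) =
          (θ ^ (-(i : ℤ))) (orbitSum θ a n) := by
        have : θ ^ (-(i : ℤ)) = θ ^ (-((i + 1 : ℕ) : ℤ)) * θ := by
          rw [← zpow_add_one]; congr 1; push_cast; ring
        rw [this]
        rfl
      rw [map_sub, h2]
      abel
    rw [h1]
    refine (norm_add_le _ _).trans ?_
    rw [norm_neg, hisom]
    push_cast
    linarith

end OrbitSum

/-! ### The partition function of a block -/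

section TraceEstimate

variable {A : Type u} [CStarAlgebra A] {H : Type v} [NormedAddCommGroup H]
  [InnerProductSpace ℂ H] [CompleteSpace H] {π : A →⋆ₐ[ℂ] (H →L[ℂ] H)} (θ : A ≃⋆ₐ[ℂ] A)

/-- The compressed orbit sum is diagonal, so its exponential is computed entry by entry; each entry
is within `2m‖a‖` of `φ(s)` since `φ` is contractive on self-adjoint elements. This gives `m` terms,
each at most `e^{2m‖a‖} Tr e^{φ(s)}`. -/
theorem re_matTrace_exp_le (hπ : Function.Injective π) {B : Type w} [CStarAlgebra B]
    [FiniteDimensional ℂ B] {τ : B →ₗ[ℂ] ℂ} (hτ : IsCanonicalTrace τ) {φ : A →ₗ[ℂ] B}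
    (hφ : IsUCP φ) {a : A} (ha : IsSelfAdjoint a) (m n : ℕ) :
    (matTrace (Fin m) τ (NormedSpace.exp
      (matMapLin (Fin m) φ (blockCompress θ hπ m (inclusion π θ (orbitSum θ a n)))))).re ≤
      m * Real.exp (m * (2 * ‖a‖)) * (τ (NormedSpace.exp (φ (orbitSum θ a n)))).re := by
  let _ := CStarAlgebra.spectralOrder B
  have _ := CStarAlgebra.spectralOrderedRing B
  have hs := isSelfAdjoint_orbitSum θ ha n
  set s := orbitSum θ a n with hsdef
  have hφs : IsSelfAdjoint (φ s) := by rw [IsSelfAdjoint, ← hφ.map_star, hs.star_eq]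
  have h1 : matMapLin (Fin m) φ (matDiag fun i : Fin m => (θ ^ (-((i : ℕ) : ℤ))) s) =
      matDiag fun i : Fin m => φ ((θ ^ (-((i : ℕ) : ℤ))) s) := by
    ext i j
    change φ (Matrix.diagonal _ i j) = Matrix.diagonal _ i j
    rw [Matrix.diagonal_apply, Matrix.diagonal_apply, apply_ite φ, map_zero]
  rw [blockCompress_inclusion, h1, exp_matDiag, matTrace_matDiag, Complex.re_sum]
  have hterm : ∀ i : Fin m, (τ (NormedSpace.exp (φ ((θ ^ (-((i : ℕ) : ℤ))) s)))).re ≤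
      Real.exp (m * (2 * ‖a‖)) * (τ (NormedSpace.exp (φ s))).re := by
    intro i
    have hsa : IsSelfAdjoint ((θ ^ (-((i : ℕ) : ℤ))) s) := by
      rw [IsSelfAdjoint, ← map_star, hs.star_eq]
    have hφi : IsSelfAdjoint (φ ((θ ^ (-((i : ℕ) : ℤ))) s)) := by
      rw [IsSelfAdjoint, ← hφ.map_star, hsa.star_eq]
    refine hτ.re_exp_le_of_norm_sub_le hφi hφs ?_
    rw [← map_sub]
    refine (hφ.norm_le_of_isSelfAdjoint (hsa.sub hs)).trans ?_
    refine (norm_pow_orbitSum_sub_le θ a n i).trans ?_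
    have : ((i : ℕ) : ℝ) ≤ m := by exact_mod_cast i.2.le
    gcongr
  refine (Finset.sum_le_sum fun i _ => hterm i).trans_eq ?_
  rw [Finset.sum_const, Finset.card_univ, Fintype.card_fin, nsmul_eq_mul, mul_assoc]

end TraceEstimate

/-! ### Comparison of the two pressures -/

section Pressure

/-- Multiplying the partition functions by a constant does not increase the growth rate. -/
theorem limsup_log_div_le {u v : ℕ → ℝ≥0∞} {c : ℝ} (hc : 0 < c)
    (huv : ∀ n, u n ≤ ENNReal.ofReal c * v n) :
    Filter.limsup (fun n : ℕ => ENNReal.log (u n) / (n : EReal)) Filter.atTop ≤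
      Filter.limsup (fun n : ℕ => ENNReal.log (v n) / (n : EReal)) Filter.atTop := by
  have h0 : Filter.Tendsto (fun n : ℕ => ((Real.log c : ℝ) : EReal) / (n : EReal)) Filter.atTop
      (nhds 0) := by
    have h1 := tendsto_const_div_atTop_nhds_zero_nat (Real.log c)
    have h2 := (continuous_coe_real_ereal.tendsto 0).comp h1
    exact h2
  have hle : ∀ n : ℕ, ENNReal.log (u n) / (n : EReal) ≤
      ((Real.log c : ℝ) : EReal) / (n : EReal) + ENNReal.log (v n) / (n : EReal) := by
    intro n
    have hn : (0 : EReal) ≤ n := by exact_mod_cast n.zero_le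
    rw [← EReal.add_div_of_nonneg_right hn, ← ENNReal.log_ofReal_of_pos hc, ← ENNReal.log_mul_add]
    exact EReal.div_le_div_right_of_nonneg hn (ENNReal.log_monotone (huv n))
  refine (Filter.limsup_le_limsup (Filter.Eventually.of_forall hle)).trans ?_
  -- Subadditivity of the limsup requires excluding `⊥ + ⊤`; the first summand tends to the finite
  -- value `0`.
  refine (EReal.limsup_add_le ?_ ?_).trans_eq ?_
  · left; rw [h0.limsup_eq]; exact EReal.zero_ne_bot
  · left; rw [h0.limsup_eq]; exact EReal.zero_ne_top
  · rw [h0.limsup_eq, zero_add]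

variable {A : Type*} [CStarAlgebra A] (θ : A ≃⋆ₐ[ℂ] A) {a : A}
  {H₀ : Type*} [NormedAddCommGroup H₀] [InnerProductSpace ℂ H₀] [CompleteSpace H₀]
  {π₀ : A →⋆ₐ[ℂ] (H₀ →L[ℂ] H₀)}
  {H : Type*} [NormedAddCommGroup H] [InnerProductSpace ℂ H] [CompleteSpace H]
  (π : A →⋆ₐ[ℂ] (H →L[ℂ] H))
  {K : Type*} [NormedAddCommGroup K] [InnerProductSpace ℂ K] [CompleteSpace K]
  (ρ : crossedProduct π₀ θ →⋆ₐ[ℂ] (K →L[ℂ] K))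

theorem inclusion_injective (hπ₀ : Function.Injective π₀) :
    Function.Injective (inclusion π₀ θ) := by
  intro x y hxy
  rw [← monomial_zero, ← monomial_zero] at hxy
  have h := congrArg (coeff θ hπ₀ 0 0) hxy
  rw [coeff_monomial, coeff_monomial] at h
  simpa using h

theorem orbitSum_inclusion (x : A) (n : ℕ) :
    orbitSum (adUnitary π₀ θ) (inclusion π₀ θ x) n = inclusion π₀ θ (orbitSum θ x n) := by
  unfold orbitSum
  rw [map_sum]
  exact Finset.sum_congr rfl fun j _ => iterate_adUnitary_inclusion π₀ θ j x

theorem forall_mem_orbitSet {C : Type*} {α : C → C} {Ω : Set C} {n : ℕ} {P : C → Prop} :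
    (∀ z ∈ orbitSet α Ω n, P z) ↔ ∀ j < n, ∀ w ∈ Ω, P (α^[j] w) := by
  simp only [orbitSet, Set.mem_iUnion, Finset.mem_range, Set.mem_image]
  constructor
  · intro h j hj w hw
    exact h _ ⟨j, hj, w, hw, rfl⟩
  · rintro h z ⟨j, hj, w, hw, rfl⟩
    exact h j hj w hw

set_option maxHeartbeats 1000000 in
/-- A completely positive approximation for the crossed product restricts to one for `A`. -/
theorem exists_restricted_approximation {Φ : (K →L[ℂ] K) →ₗ[ℂ] (H →L[ℂ] H)} (hΦ : IsUCP Φ)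
    (hΦπ : ∀ x, Φ (ρ (inclusion π₀ θ x)) = π x) {Ω : Set A} {δ : ℝ} {n : ℕ}
    (c : CPA ρ (orbitSet (adUnitary π₀ θ) (inclusion π₀ θ '' Ω) n) (δ / 2)) (a : A) :
    ∃ d : CPA π (orbitSet θ Ω n) δ, (d.Tr (NormedSpace.exp (d.φ (orbitSum θ a n)))).re =
      (c.Tr (NormedSpace.exp
        (c.φ (orbitSum (adUnitary π₀ θ) (inclusion π₀ θ a) n)))).re := by
  have happ : ∀ x ∈ orbitSet θ Ω n,
      ‖(Φ ∘ₗ c.ψ) ((c.φ ∘ₗ (inclusion π₀ θ : A →ₗ[ℂ] crossedProduct π₀ θ)) x) - π x‖ < δ := by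
    refine forall_mem_orbitSet.2 fun j hj w hw => ?_
    have h1 := forall_mem_orbitSet.1 c.approx j hj _ ⟨w, hw, rfl⟩
    rw [iterate_adUnitary_inclusion π₀ θ j w] at h1
    have h2 : (Φ ∘ₗ c.ψ) ((c.φ ∘ₗ (inclusion π₀ θ : A →ₗ[ℂ] crossedProduct π₀ θ)) (θ^[j] w)) =
        Φ (c.ψ (c.φ (inclusion π₀ θ (θ^[j] w)))) := rfl
    rw [← hΦπ, h2, ← map_sub]
    -- The factor 2 of `IsUCP.norm_le` is why the given approximation has tolerance `δ / 2`.
    refine (hΦ.norm_le _).trans_lt ?_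
    linarith
  refine ⟨⟨c.B, c.φ ∘ₗ (inclusion π₀ θ : A →ₗ[ℂ] crossedProduct π₀ θ), Φ ∘ₗ c.ψ, c.Tr,
    c.isUCP_φ.comp (isUCP_starAlgHom _), hΦ.comp c.isUCP_ψ, c.isCanonicalTrace, happ⟩, ?_⟩
  exact congrArg (fun y => (c.Tr (NormedSpace.exp (c.φ y))).re)
    (orbitSum_inclusion (π₀ := π₀) θ a n).symm

set_option maxHeartbeats 1000000 in
/-- The pressure does not decrease on passing to the crossed product. -/
theorem pressure_le_pressure_adUnitary (hπ₀ : Function.Injective π₀)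
    (hρ : Function.Injective ρ) :
    pressure π θ a ≤ pressure ρ (adUnitary π₀ θ) (inclusion π₀ θ a) := by
  classical
  obtain ⟨Φ, hΦ, hΦπ⟩ := exists_ucp_extension (ρ.comp (inclusion π₀ θ))
    (hρ.comp (inclusion_injective θ hπ₀)) π
  refine iSup_le fun Ω => iSup_le fun ⟨δ, hδ⟩ => ?_
  refine le_trans ?_ (le_iSup_of_le (Ω.image (inclusion π₀ θ))
    (le_iSup_of_le ⟨δ / 2, Set.mem_Ioi.2 (half_pos hδ)⟩ le_rfl))
  refine limsup_log_div_le one_pos fun n => ?_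
  rw [ENNReal.ofReal_one, one_mul, Finset.coe_image]
  refine le_iInf fun c => ?_
  obtain ⟨d, hd⟩ := exists_restricted_approximation θ π ρ hΦ hΦπ c a
  rw [← hd]
  exact iInf_le _ d

set_option maxHeartbeats 1000000 in
/-- A completely positive approximation for `A` induces one for the crossed product. -/
theorem exists_induced_approximation (ha : IsSelfAdjoint a) (hπ₀ : Function.Injective π₀)
    {Φ : (H →L[ℂ] H) →ₗ[ℂ] (K →L[ℂ] K)} (hΦ : IsUCP Φ)
    (hΦπ : ∀ x, Φ (π x) = ρ (inclusion π₀ θ x)) {Ω : Set (crossedProduct π₀ θ)} {ε δ : ℝ}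
    {X : Set A} {m : ℕ} (hm : 0 < m)
    (happ : ∀ (j : ℕ) (f : A →ₗ[ℂ] (K →L[ℂ] K)), IsUCP f →
      (∀ x ∈ X, ‖f (θ^[j] x) - ρ (inclusion π₀ θ (θ^[j] x))‖ < δ) → ∀ z ∈ Ω,
      ‖blockMap θ hπ₀ (repUnitary θ ρ) m f ((adUnitary π₀ θ)^[j] z) -
        ρ ((adUnitary π₀ θ)^[j] z)‖ < ε) {n : ℕ} (c : CPA π (orbitSet θ X n) (δ / 2)) :
    ∃ d : CPA ρ (orbitSet (adUnitary π₀ θ) Ω n) ε,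
      (d.Tr (NormedSpace.exp (d.φ (orbitSum (adUnitary π₀ θ) (inclusion π₀ θ a) n)))).re ≤
        m * Real.exp (m * (2 * ‖a‖)) *
          (c.Tr (NormedSpace.exp (c.φ (orbitSum θ a n)))).re := by
  have hψ : IsUCP (Φ ∘ₗ c.ψ) := hΦ.comp c.isUCP_ψ
  have hf : IsUCP ((Φ ∘ₗ c.ψ) ∘ₗ c.φ) := hψ.comp c.isUCP_φ
  have happ' : ∀ z ∈ orbitSet (adUnitary π₀ θ) Ω n,
      ‖(average (repUnitary θ ρ) m ∘ₗ matMapLin (Fin m) (Φ ∘ₗ c.ψ))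
        ((matMapLin (Fin m) c.φ ∘ₗ blockCompress θ hπ₀ m) z) - ρ z‖ < ε := by
    refine forall_mem_orbitSet.2 fun j hj w hw => ?_
    -- Entrywise maps compose, so the composite through `M_m(B)` is by definition `blockMap` for `f
    -- = Φ ∘ ψ ∘ φ`.
    refine happ j ((Φ ∘ₗ c.ψ) ∘ₗ c.φ) hf (fun x hx => ?_) w hw
    have h1 := forall_mem_orbitSet.1 c.approx j hj x hx
    rw [← hΦπ, LinearMap.comp_apply, LinearMap.comp_apply, ← map_sub]
    refine (hΦ.norm_le _).trans_lt ?_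
    linarith
  refine ⟨⟨MatAlg (Fin m) c.B, matMapLin (Fin m) c.φ ∘ₗ blockCompress θ hπ₀ m,
    average (repUnitary θ ρ) m ∘ₗ matMapLin (Fin m) (Φ ∘ₗ c.ψ), matTrace (Fin m) c.Tr,
    (c.isUCP_φ.matMapLin (Fin m)).comp (isUCP_blockCompress θ hπ₀ m),
    (isUCP_average _ hm).comp (hψ.matMapLin (Fin m)), c.isCanonicalTrace.matTrace, happ'⟩, ?_⟩
  rw [orbitSum_inclusion]
  exact re_matTrace_exp_le θ hπ₀ c.isCanonicalTrace c.isUCP_φ ha m n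

set_option maxHeartbeats 1000000 in
/-- The pressure does not increase on passing to the crossed product. -/
theorem pressure_adUnitary_le_pressure (ha : IsSelfAdjoint a) (hπ₀ : Function.Injective π₀)
    (hπ : Function.Injective π) :
    pressure ρ (adUnitary π₀ θ) (inclusion π₀ θ a) ≤ pressure π θ a := by
  obtain ⟨Φ, hΦ, hΦπ⟩ := exists_ucp_extension π hπ (ρ.comp (inclusion π₀ θ))
  refine iSup_le fun Ω => iSup_le fun ⟨ε, hε⟩ => ?_
  obtain ⟨m, hm, X, δ, hδ, happ⟩ := exists_approximation θ ρ hπ₀ Ω (Set.mem_Ioi.1 hε)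
  refine le_trans ?_ (le_iSup_of_le X
    (le_iSup_of_le ⟨δ / 2, Set.mem_Ioi.2 (half_pos hδ)⟩ le_rfl))
  have hm' : (0 : ℝ) < m := by exact_mod_cast hm
  have hc : 0 < m * Real.exp (m * (2 * ‖a‖)) := by positivity
  refine limsup_log_div_le hc fun n => ?_
  -- The constant is neither `0` nor `⊤`, so it passes through the infimum even when there is no
  -- approximation and the infimum is `⊤`.
  rw [partitionFunction, partitionFunction,
    ENNReal.mul_iInf_of_ne (ENNReal.ofReal_pos.2 hc).ne' ENNReal.ofReal_ne_top]
  refine le_iInf fun c => ?_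
  obtain ⟨d, hd⟩ := exists_induced_approximation θ π ρ ha hπ₀ hΦ hΦπ hm happ c
  rw [← ENNReal.ofReal_mul hc.le]
  exact (iInf_le _ d).trans (ENNReal.ofReal_le_ofReal hd)

end Pressure

end CStarPressure

end

theorem theorem5p5 {A : Type*} [CStarAlgebra A] (hA : CStarPressure.IsExact A)
    (θ : A ≃⋆ₐ[ℂ] A) (a : A) (ha : IsSelfAdjoint a)
    -- a faithful unital representation used to form the crossed product
    {H₀ : Type*} [NormedAddCommGroup H₀] [InnerProductSpace ℂ H₀] [CompleteSpace H₀]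
    (π₀ : A →⋆ₐ[ℂ] (H₀ →L[ℂ] H₀)) (hπ₀ : Function.Injective π₀)
    -- faithful unital representations used to compute the two pressures
    {H : Type*} [NormedAddCommGroup H] [InnerProductSpace ℂ H] [CompleteSpace H]
    (π : A →⋆ₐ[ℂ] (H →L[ℂ] H)) (hπ : Function.Injective π)
    {K : Type*} [NormedAddCommGroup K] [InnerProductSpace ℂ K] [CompleteSpace K]
    (ρ : CStarPressure.crossedProduct π₀ θ →⋆ₐ[ℂ] (K →L[ℂ] K)) (hρ : Function.Injective ρ) :
    CStarPressure.pressure π θ a =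
      CStarPressure.pressure ρ (CStarPressure.adUnitary π₀ θ)
        (CStarPressure.inclusion π₀ θ a) :=
  le_antisymm (CStarPressure.pressure_le_pressure_adUnitary θ π ρ hπ₀ hρ)
    (CStarPressure.pressure_adUnitary_le_pressure θ π ρ ha hπ₀ hπ)
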